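/- All rings have a unit, ring homomorphisms preserve units, and modules are left modules. A group isogeny is a group homomorphism $f\colon H\to G$ such that $\ker f$ is finite and $(G:fH)$ is finite; its index is $\mathrm{i}(f)=(G:fH)/\#\ker f$. An isogeny of rings, or of modules over a ring, is a homomorphism of rings, respectively modules, that is an isogeny of the underlying additive groups, and its index is the index of that group isogeny. A correspondence $c=(W,f,g)\colon X\rightleftharpoons Y$ of groups, rings or modules over a ring consists of an object $W$ and morphisms $f\colon W\to X$, $g\colon W\to Y$; it is a commensurability if $f$ and $g$ are both isogenies, and its index is then $\mathrm{i}(c)=\mathrm{i}(g)/\mathrm{i}(f)$. For a correspondence $c=(N,f,g)\colon L\rightleftharpoons M$ of modules over a ring $R$, let $\operatorname{End}c$ be the subring $\{(\lambda,\nu,\mu):\lambda f=f\nu,\ \mu g=g\nu\}$ of $\operatorname{End}_R L\times\operatorname{End}_R N\times\operatorname{End}_R M$. Let $\mathrm{e}(c)\colon\operatorname{End}L\rightleftharpoons\operatorname{End}M$ be the ring correspondence consisting of $\operatorname{End}c$ and the maps $(\lambda,\nu,\mu)\mapsto\lambda$ and $(\lambda,\nu,\mu)\mapsto\mu$, and let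 $\mathrm{a}(c)\colon\operatorname{Aut}L\rightleftharpoons\operatorname{Aut}M$ be the group correspondence consisting of $\operatorname{Aut}c=(\operatorname{End}c)^\times$ and the induced maps to $\operatorname{Aut}L=(\operatorname{End}L)^\times$ and $\operatorname{Aut}M=(\operatorname{End}M)^\times$. **Theorem.** Let $Z$ be an infinite domain such that $Z/mZ$ is finite for every non-zero $m\in Z$, let $Q$ be the field of fractions of $Z$, let $A$ be a semisimple $Q$-algebra of finite dimension over $Q$, let $R\subset A$ be a sub-$Z$-algebra with $Q\cdot R=A$ (that is, $R$ spans $A$ over $Q$), and let $L$, $M$ be finitely generated $R$-modules. Regard $Q\otimes_Z L$ and $Q\otimes_Z M$ as $A$-modules through $(pr)(q\otimes x)=pq\otimes rx$ for $p,q\in Q$ and $r\in R$. Then: (a) there is an $R$-module commensurability $L\rightleftharpoons M$ if and only if the $A$-modules $Q\otimes_Z L$ and $Q\otimes_Z M$ are isomorphic; (b) if $c\colon L\rightleftharpoons M$ is an $R$-module commensurability, then $\mathrm{e}(c)\colon\operatorname{End}L\rightleftharpoons\operatorname{End}M$ is a ring commensurability and $\mathrm{a}(c)\colon\operatorname{Aut}L\rightleftharpoons\operatorname{Aut}M$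 is a group commensurability; (c) if $c,c'\colon L\rightleftharpoons M$ are $R$-module commensurabilities, then $\mathrm{i}(\mathrm{e}(c))=\mathrm{i}(\mathrm{e}(c'))$ and $\mathrm{i}(\mathrm{a}(c))=\mathrm{i}(\mathrm{a}(c'))$. -/

import Mathlib

open scoped TensorProduct

universe u v

/-! ### Isogenies and their indices -/

/-- A group isogeny: a group homomorphism with finite kernel whose image has finite index. -/
def IsGroupIsogeny {H G : Type*} [Group H] [Group G] (f : H →* G) : Prop :=
  Finite f.ker ∧ f.range.FiniteIndex

/-- The index `(G : f H) / #ker f` of a group isogeny `f : H → G`. -/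
noncomputable def groupIsogenyIndex {H G : Type*} [Group H] [Group G] (f : H →* G) : ℚ :=
  (f.range.index : ℚ) / (Nat.card f.ker : ℚ)

/-- An isogeny of additive groups: `IsGroupIsogeny` in additive notation. -/
def IsAddIsogeny {H G : Type*} [AddGroup H] [AddGroup G] (f : H →+ G) : Prop :=
  Finite f.ker ∧ f.range.FiniteIndex

/-- The index of an isogeny of additive groups: `groupIsogenyIndex` in additive notation. -/
noncomputable def addIsogenyIndex {H G : Type*} [AddGroup H] [AddGroup G] (f : H →+ G) : ℚ :=
  (f.range.index : ℚ) / (Nat.card f.ker : ℚ)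

/-! ### Correspondences and commensurabilities of groups, rings and modules -/

/-- A correspondence `X ← W → Y` in the category of groups. -/
structure GroupCorrespondence (X Y : Type u) [Group X] [Group Y] where
  W : Type u
  [group : Group W]
  f : W →* X
  g : W →* Y

attribute [instance] GroupCorrespondence.group

namespace GroupCorrespondence

variable {X Y : Type u} [Group X] [Group Y]

/-- A group commensurability: both legs are isogenies. -/
def IsCommensurability (c : GroupCorrespondence X Y) : Prop :=
  IsGroupIsogeny c.f ∧ IsGroupIsogeny c.g

/-- The index `i(g) / i(f)` of a group commensurability `(W, f, g)`. -/
noncomputable def index (c : GroupCorrespondence X Y) : ℚ :=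
  groupIsogenyIndex c.g / groupIsogenyIndex c.f

end GroupCorrespondence

/-- A correspondence `X ← W → Y` in the category of (unital) rings. -/
structure RingCorrespondence (X Y : Type u) [Ring X] [Ring Y] where
  W : Type u
  [ring : Ring W]
  f : W →+* X
  g : W →+* Y

attribute [instance] RingCorrespondence.ring

namespace RingCorrespondence

variable {X Y : Type u} [Ring X] [Ring Y]

/-- A ring commensurability: both legs are isogenies of the additive groups. -/
def IsCommensurability (c : RingCorrespondence X Y) : Prop :=
  IsAddIsogeny c.f.toAddMonoidHom ∧ IsAddIsogeny c.g.toAddMonoidHom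

/-- The index `i(g) / i(f)` of a ring commensurability `(W, f, g)`. -/
noncomputable def index (c : RingCorrespondence X Y) : ℚ :=
  addIsogenyIndex c.g.toAddMonoidHom / addIsogenyIndex c.f.toAddMonoidHom

end RingCorrespondence

/-- A correspondence `L ← N → M` in the category of left `R`-modules. -/
structure ModuleCorrespondence (R : Type u) [Ring R] (L M : Type v)
    [AddCommGroup L] [Module R L] [AddCommGroup M] [Module R M] where
  N : Type v
  [addCommGroup : AddCommGroup N]
  [module : Module R N]
  f : N →ₗ[R] L
  g : N →ₗ[R] M

attribute [instance] ModuleCorrespondence.addCommGroup ModuleCorrespondence.module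

namespace ModuleCorrespondence

variable {R : Type u} [Ring R] {L M : Type v}
  [AddCommGroup L] [Module R L] [AddCommGroup M] [Module R M]

/-- An `R`-module commensurability: both legs are isogenies of the additive groups. -/
def IsCommensurability (c : ModuleCorrespondence R L M) : Prop :=
  IsAddIsogeny c.f.toAddMonoidHom ∧ IsAddIsogeny c.g.toAddMonoidHom

/-- The endomorphism ring of a correspondence `c = (N, f, g)`: the subring of all
`(lam, nu, mu)` in `End L × End N × End M` with `lam f = f nu` and `mu g = g nu`. -/
def endRing (c : ModuleCorrespondence R L M) :
    Subring (Module.End R L × Module.End R c.N × Module.End R M) where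
  carrier := {t | t.1 ∘ₗ c.f = c.f ∘ₗ t.2.1 ∧ t.2.2 ∘ₗ c.g = c.g ∘ₗ t.2.1}
  zero_mem' := by constructor <;> ext x <;> simp
  one_mem' := by constructor <;> ext x <;> simp
  add_mem' := by
    rintro a b ⟨ha, ha'⟩ ⟨hb, hb'⟩
    constructor
    · simp [LinearMap.add_comp, LinearMap.comp_add, ha, hb]
    · simp [LinearMap.add_comp, LinearMap.comp_add, ha', hb']
  neg_mem' := by
    rintro a ⟨ha, ha'⟩
    constructor
    · simp [LinearMap.neg_comp, LinearMap.comp_neg, ha]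
    · simp [LinearMap.neg_comp, LinearMap.comp_neg, ha']
  mul_mem' := by
    rintro a b ⟨ha, ha'⟩ ⟨hb, hb'⟩
    constructor
    · change (a.1 ∘ₗ b.1) ∘ₗ c.f = c.f ∘ₗ (a.2.1 ∘ₗ b.2.1)
      rw [LinearMap.comp_assoc, hb, ← LinearMap.comp_assoc, ha, LinearMap.comp_assoc]
    · change (a.2.2 ∘ₗ b.2.2) ∘ₗ c.g = c.g ∘ₗ (a.2.1 ∘ₗ b.2.1)
      rw [LinearMap.comp_assoc, hb', ← LinearMap.comp_assoc, ha', LinearMap.comp_assoc]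

/-- The ring homomorphism `End c → End L`, `(lam, nu, mu) ↦ lam`. -/
def endFst (c : ModuleCorrespondence R L M) : c.endRing →+* Module.End R L :=
  (RingHom.fst _ _).comp c.endRing.subtype

/-- The ring homomorphism `End c → End M`, `(lam, nu, mu) ↦ mu`. -/
def endSnd (c : ModuleCorrespondence R L M) : c.endRing →+* Module.End R M :=
  ((RingHom.snd _ _).comp (RingHom.snd _ _)).comp c.endRing.subtype

/-- The ring correspondence `e(c) : End L ← End c → End M`. -/
def e (c : ModuleCorrespondence R L M) :
    RingCorrespondence (Module.End R L) (Module.End R M) where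
  W := c.endRing
  f := c.endFst
  g := c.endSnd

/-- The group correspondence `a(c) : Aut L ← Aut c → Aut M`. Here `Aut c`, `Aut L` and `Aut M`
are the unit groups of `End c`, `End L` and `End M`, and the maps are induced by those of
`e(c)`. -/
def a (c : ModuleCorrespondence R L M) :
    GroupCorrespondence (Module.End R L)ˣ (Module.End R M)ˣ where
  W := (c.endRing)ˣ
  f := Units.map (c.endFst : c.endRing →* Module.End R L)
  g := Units.map (c.endSnd : c.endRing →* Module.End R M)

end ModuleCorrespondence

/-! ### The `A`-module `Q ⊗ L` -/

section TensorAction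

variable {Z : Type*} [CommRing Z] (Q : Type*) [Field Q] [Algebra Z Q]
  {A : Type*} [Ring A] [Algebra Z A] (R : Subalgebra Z A)
  (L : Type*) [AddCommGroup L] [Module R L] [Module Z L] [IsScalarTower Z R L]

/-- The action of `Q ⊗ R` on `Q ⊗ L`, in which `q ⊗ r` sends `q' ⊗ l` to `q q' ⊗ r l`. -/
noncomputable def tensorAction :
    Q ⊗[Z] R →ₐ[Q] Module.End Q (Q ⊗[Z] L) :=
  Algebra.TensorProduct.lift (Algebra.ofId Q (Module.End Q (Q ⊗[Z] L)))
    ((Module.End.baseChangeHom Z Q L).comp (Algebra.lsmul Z Z L : R →ₐ[Z] Module.End Z L))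
    (fun q _ => show Commute _ _ from Algebra.commutes q _)

theorem tensorAction_tmul
    (p q : Q) (r : R) (l : L) :
    tensorAction Q R L (p ⊗ₜ[Z] r) (q ⊗ₜ[Z] l) = (p * q) ⊗ₜ[Z] (r • l) := by
  rw [tensorAction, Algebra.TensorProduct.lift_tmul]
  rfl

end TensorAction

section ScalarExtension

variable {Z : Type*} [CommRing Z] (Q : Type*) [Field Q] [Algebra Z Q]
  {A : Type*} [Ring A] [Algebra Q A] [Algebra Z A] [IsScalarTower Z Q A]

/-- The natural ring homomorphism `Q ⊗ R → A`, `q ⊗ r ↦ q r`. -/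
noncomputable def tensorToAlgebra (R : Subalgebra Z A) : Q ⊗[Z] R →ₐ[Q] A :=
  Algebra.TensorProduct.lift (Algebra.ofId Q A) R.val
    (fun q r => show Commute _ _ from Algebra.commutes q (r : A))

theorem tensorToAlgebra_tmul (R : Subalgebra Z A) (q : Q) (r : R) :
    tensorToAlgebra Q R (q ⊗ₜ r) = q • (r : A) := by
  rw [tensorToAlgebra, Algebra.TensorProduct.lift_tmul, Algebra.ofId_apply, Algebra.smul_def]
  rfl

theorem tensorToAlgebra_bijective [IsDomain Z] [IsFractionRing Z Q] (R : Subalgebra Z A)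
    (hR : Submodule.span Q (R : Set A) = ⊤) : Function.Bijective (tensorToAlgebra Q R) := by
  constructor
  · have key : ∀ x : Q ⊗[Z] R, ∃ s : Z, s ≠ 0 ∧ ∃ r : R,
        (algebraMap Z Q s) • x = (1 : Q) ⊗ₜ[Z] r := by
      intro x
      induction x using TensorProduct.induction_on with
      | zero => exact ⟨1, one_ne_zero, 0, by simp⟩
      | tmul q r =>
        obtain ⟨n, d, hd, rfl⟩ := IsFractionRing.div_surjective (A := Z) q
        have hd0 : d ≠ 0 := nonZeroDivisors.ne_zero hd
        have hdQ : algebraMap Z Q d ≠ 0 := by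
          simpa using hd0
        refine ⟨d, hd0, n • r, ?_⟩
        rw [TensorProduct.smul_tmul', smul_eq_mul, mul_div_cancel₀ _ hdQ,
          ← TensorProduct.smul_tmul, Algebra.smul_def, mul_one]
      | add x y hx hy =>
        obtain ⟨s, hs, r, h⟩ := hx
        obtain ⟨t, ht, r', h'⟩ := hy
        refine ⟨s * t, mul_ne_zero hs ht, t • r + s • r', ?_⟩
        have e1 : ∀ (z : Z) (w : R),
            (1 : Q) ⊗ₜ[Z] (z • w) = algebraMap Z Q z • ((1 : Q) ⊗ₜ[Z] w) := by
          intro z w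
          rw [← TensorProduct.smul_tmul, TensorProduct.smul_tmul', Algebra.smul_def, smul_eq_mul]
        rw [TensorProduct.tmul_add, e1, e1, ← h, ← h', smul_add, smul_smul, smul_smul, map_mul,
          mul_comm (algebraMap Z Q t)]
    rw [injective_iff_map_eq_zero]
    intro x hx
    obtain ⟨s, hs, r, h⟩ := key x
    have hsQ : algebraMap Z Q s ≠ 0 := by simpa using hs
    have hr : r = 0 := by
      have := congrArg (tensorToAlgebra Q R) h
      rw [map_smul, hx, smul_zero, tensorToAlgebra_tmul, one_smul] at this
      exact Subtype.ext this.symm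
    rw [hr, TensorProduct.tmul_zero] at h
    exact (smul_eq_zero.mp h).resolve_left hsQ
  · have : (R : Set A) ⊆ LinearMap.range (tensorToAlgebra Q R).toLinearMap := by
      intro r hr
      exact ⟨(1 : Q) ⊗ₜ[Z] (⟨r, hr⟩ : R), by simp [tensorToAlgebra_tmul]⟩
    have h2 := Submodule.span_le.mpr this
    rw [hR] at h2
    intro a
    exact h2 (Submodule.mem_top (x := a))

variable [IsDomain Z] [IsFractionRing Z Q] (R : Subalgebra Z A)
  (hR : Submodule.span Q (R : Set A) = ⊤)
  (L : Type*) [AddCommGroup L] [Module R L] [Module Z L] [IsScalarTower Z R L]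

/-- The action of `A = Q ⊗ R` on `Q ⊗ L`, through `tensorAction`. -/
noncomputable def scalarExtensionAction : A →ₐ[Q] Module.End Q (Q ⊗[Z] L) :=
  (tensorAction Q R L).comp
    (AlgEquiv.ofBijective (tensorToAlgebra Q R)
      (tensorToAlgebra_bijective Q R hR)).symm.toAlgHom

/-- The `A`-module structure on `Q ⊗ L`. -/
@[reducible] noncomputable def scalarExtensionModule : Module A (Q ⊗[Z] L) :=
  Module.compHom (Q ⊗[Z] L) (scalarExtensionAction Q R hR L).toRingHom

/-- The `A`-module structure on `Q ⊗ L` is characterized by `(p r) (q ⊗ l) = p q ⊗ r l`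
for `p, q ∈ Q`, `r ∈ R` and `l ∈ L`. -/
theorem scalarExtensionModule_smul_tmul (p q : Q) (r : R) (l : L) :
    letI := scalarExtensionModule Q R hR L
    (p • (r : A)) • (q ⊗ₜ[Z] l) = (p * q) ⊗ₜ[Z] (r • l) := by
  change scalarExtensionAction Q R hR L (p • (r : A)) (q ⊗ₜ[Z] l) = _
  have h : (AlgEquiv.ofBijective (tensorToAlgebra Q R)
      (tensorToAlgebra_bijective Q R hR)).symm (p • (r : A)) = p ⊗ₜ[Z] r := by
    rw [AlgEquiv.symm_apply_eq]
    simp [tensorToAlgebra_tmul]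
  change tensorAction Q R L ((AlgEquiv.ofBijective (tensorToAlgebra Q R)
      (tensorToAlgebra_bijective Q R hR)).symm (p • (r : A))) (q ⊗ₜ[Z] l) = _
  rw [h, tensorAction_tmul]

end ScalarExtension

/-!
Write `V = Q ⊗ L`, `V' = Q ⊗ M` and `B = End_A V`.

**Isogenies and isomorphisms.** Since `Z` is infinite, the kernel of an isogeny of `R`-modules is
killed by a non-zero element of `Z`, and its cokernel as well, so that an isogeny has an inverse up
to multiplication by a non-zero scalar (`IsAddIsogeny.exists_quasiInverse`). A commensurability
`c = (N, f, g)` therefore induces an isomorphism `φ_c : V ≃ V'`. Conversely, an isomorphism `V ≃ V'`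
lifts, up to a denominator `d`, to a homomorphism `p : L → M`, and `(L, d, p)` is a commensurability
that induces it (`ModuleCorrespondence.exists_isCommensurability_induces`).

**Finiteness.** The converse direction needs that `L` has finite torsion and that `L / mL` is finite
for `m ≠ 0`. Finiteness of the torsion is where semisimplicity of `A` enters for the first time
(`finite_torsion_of_finite`). Thus `L` maps to a finite dimensional `Q`-vector space with finite
kernel, and finiteness of `L / mL` comes down to that of `J / mJ` for `J ⊆ Q`, where it follows from
`(I : mI) = (Z : mZ)` for ideals `I ≠ 0`. The same holds for `End L`, which embeds in some `Lᵏ`.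

**Endomorphisms and automorphisms.** Inverses of `f` and `g` up to scalars give a section
of `End c → End L` up to a scalar `k`, multiplicative up to `k`. This makes `End c → End L` an
isogeny, and shows that the image of `Aut c` in `Aut L` contains a congruence subgroup
(`isIsogeny_of_section`).

**Independence of the indices.** Let `ρ_L` and `ρ_M` be the maps from `End L` and `End M` to the
endomorphism rings of `V` and `V'`; they have finite kernels. Up to a factor that depends only
on `L` and `M`, the index of `e(c)` is the generalized index of `ρ_M (End M)` with respect to the
conjugate of `ρ_L (End L)` by `φ_c` (`groupIsogenyIndex_div`). If `c'` is a second commensurability,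
then `φ_c` and `φ_{c'}` differ by an element of `Bˣ`, and it remains to prove that conjugation by
`b ∈ Bˣ` preserves the size of `Γ = ρ_L (End L)`. As `b` is itself induced by a commensurability from
`L` to `L`, the groups `b Γ b⁻¹` and `Γ` are commensurable, and `b ↦ [b Γ b⁻¹ : Γ]` is a homomorphism
from `Bˣ` to the positive rationals, which is trivial on central units. As `B` is semisimple and the
positive rationals are a torsion-free group, such a homomorphism is trivial
(`semisimple_character_eq_one`): by Wedderburn's structure theorem and Gaussian elimination the claim
reduces to division algebras `D`, and there Wedderburn's factorization of the minimal polynomial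
of `a` shows that a product of conjugates of `a` is central up to sign. The same argument with unit
groups in the place of rings applies to `a(c)`.
-/

/-! ### Characters of division algebras -/

section DivisionRing

open Polynomial

variable {D : Type*} [DivisionRing D]

/-- Conjugation `x ↦ u x u⁻¹` by a unit `u`, as a ring endomorphism. -/
def unitsConj {B : Type*} [Ring B] (u : Bˣ) : B →+* B :=
  MulSemiringAction.toRingHom (ConjAct Bˣ) B (ConjAct.toConjAct u)

theorem unitsConj_apply {B : Type*} [Ring B] (u : Bˣ) (x : B) :
    unitsConj u x = u * x * ↑u⁻¹ := rfl

/-- Evaluation of a product of polynomials over a division ring, with evaluation on the right. -/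
theorem eval_mul_of_eval_ne_zero (g h : D[X]) (x : D) (c : Dˣ) (hc : h.eval x = c) :
    (g * h).eval x = g.eval (unitsConj c x) * c := by
  induction g using Polynomial.induction_on' with
  | add p q hp hq => rw [add_mul, eval_add, hp, hq, eval_add, add_mul]
  | monomial n d =>
    have h1 : ∀ m : ℕ, (h * X ^ m).eval x = c * x ^ m := by
      intro m
      induction m with
      | zero => simp [hc]
      | succ m ih => rw [pow_succ, ← mul_assoc, eval_mul_X, ih, pow_succ, mul_assoc]
    have h2 : (X ^ n : D[X]).eval (unitsConj c x) = unitsConj c x ^ n := by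
      rw [X_pow_eq_monomial, eval_monomial, one_mul]
    rw [← C_mul_X_pow_eq_monomial, mul_assoc, X_pow_mul, eval_C_mul, h1, eval_C_mul, h2,
      ← map_pow, unitsConj_apply]
    simp [mul_assoc]

theorem exists_eq_mul_X_sub_C (p : D[X]) (x : D) (hx : p.eval x = 0) :
    ∃ q : D[X], p = q * (X - C x) := by
  have key : ∀ p : D[X], ∃ q : D[X], p = q * (X - C x) + C (p.eval x) := by
    intro p
    induction p using Polynomial.induction_on' with
    | add p q hp hq =>
      obtain ⟨r, hr⟩ := hp
      obtain ⟨s, hs⟩ := hq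
      refine ⟨r + s, ?_⟩
      rw [eval_add, C_add, add_mul]
      nth_rw 1 [hr, hs]
      abel
    | monomial n d =>
      refine ⟨C d * ∑ i ∈ Finset.range n, X ^ i * (C x) ^ (n - 1 - i), ?_⟩
      rw [mul_assoc, Commute.geom_sum₂_mul (X_mul_C x), eval_monomial, ← C_mul_X_pow_eq_monomial,
        mul_sub, C_mul, C_pow, sub_add_cancel]
  obtain ⟨q, hq⟩ := key p
  exact ⟨q, by rw [hx, C_0, add_zero] at hq; exact hq⟩

/-- **Wedderburn's factorization**, read through a character. Let `p` be the monic polynomial of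
least degree `r` that vanishes on the conjugacy class of `a`. It has central coefficients and is
a product of `r` factors `X - aᵢ` with each `aᵢ` conjugate to `a`; its constant coefficient shows
that a character which is trivial on the center takes the value `1` at `a ^ r`. -/
theorem divisionAlgebra_character_eq_one {Q : Type*} [Field Q] [Algebra Q D]
    [Algebra.IsIntegral Q D] {C' : Type*} [CommGroup C'] [IsMulTorsionFree C']
    (ξ : Dˣ →* C') (hξ : ∀ z : Dˣ, (∀ x : D, z * x = x * z) → ξ z = 1) (a : Dˣ) :
    ξ a = 1 := by
  classical
  let S : Set D[X] := {p | p.Monic ∧ ∀ u : Dˣ, p.eval (unitsConj u (a : D)) = 0}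
  have hS : ∃ r, ∃ p ∈ S, p.natDegree = r := by
    refine ⟨_, (minpoly Q (a : D)).map (algebraMap Q D), ⟨?_, fun u => ?_⟩, rfl⟩
    · exact (minpoly.monic (Algebra.IsIntegral.isIntegral (a : D))).map _
    · have h1 : (minpoly Q (a : D)).map (algebraMap Q D) =
          ((minpoly Q (a : D)).map (algebraMap Q D)).map (unitsConj u) := by
        rw [Polynomial.map_map]
        congr 1
        ext q
        rw [RingHom.comp_apply, unitsConj_apply, ← Algebra.commutes, mul_assoc]
        simp
      rw [h1, eval_map_apply, eval_map_algebraMap, minpoly.aeval, map_zero]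
  obtain ⟨p, ⟨hpm, hp0⟩, hpr⟩ := Nat.find_spec hS
  set r := Nat.find hS with hr
  have hmin : ∀ q : D[X], q ≠ 0 → q.natDegree < r →
      ∃ u : Dˣ, q.eval (unitsConj u (a : D)) ≠ 0 := by
    intro q hq hqr
    by_contra! hcon
    refine Nat.find_min hS hqr ⟨C q.leadingCoeff⁻¹ * q, ⟨?_, fun u => ?_⟩, ?_⟩
    · rw [Monic, leadingCoeff_mul, leadingCoeff_C,
        inv_mul_cancel₀ (leadingCoeff_ne_zero.mpr hq)]
    · rw [eval_C_mul, hcon, mul_zero]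
    · exact natDegree_C_mul (inv_ne_zero (leadingCoeff_ne_zero.mpr hq))
  -- Conjugating the coefficients of `p` gives another monic polynomial of the same kind.
  have hcent : ∀ u : Dˣ, p.map (unitsConj u) = p := by
    intro u
    by_contra hne
    have hlt : (p.map (unitsConj u) - p).natDegree < r := by
      rw [← hpr]
      have hd : (p.map (unitsConj u)).degree = p.degree := degree_map _ _
      refine natDegree_lt_natDegree (sub_ne_zero.mpr hne) ?_
      rw [← hd]
      refine degree_sub_lt_left hd (by rw [Ne, ← degree_eq_bot, hd]; simpa using hpm.ne_zero) ?_
      rw [(hpm.map _).leadingCoeff, hpm.leadingCoeff]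
    obtain ⟨w, hw⟩ := hmin _ (sub_ne_zero.mpr hne) hlt
    apply hw
    have h2 : unitsConj w (a : D) = unitsConj u (unitsConj (u⁻¹ * w) (a : D)) := by
      simp [unitsConj_apply, mul_assoc]
    rw [eval_sub, hp0 w, h2, eval_map_apply, hp0, map_zero, sub_zero]
  have hfac : ∀ k ≤ r, ∃ g h : D[X], p = g * h ∧ h.Monic ∧ h.natDegree = k ∧
      ∃ y : Dˣ, h.coeff 0 = y ∧ ξ y = ξ (-a) ^ k := by
    intro k
    induction k with
    | zero => exact fun _ => ⟨p, 1, by simp, monic_one, by simp, 1, by simp, by simp⟩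
    | succ k ih =>
      intro hk
      obtain ⟨g, h, hgh, hm, hdeg, y, hy, hξy⟩ := ih (by omega)
      obtain ⟨u, hu⟩ := hmin h hm.ne_zero (by omega)
      let c : Dˣ := Units.mk0 _ hu
      have hg : g.eval (unitsConj c (unitsConj u (a : D))) = 0 := by
        have := hp0 u
        rw [hgh, eval_mul_of_eval_ne_zero g h _ c rfl] at this
        exact (mul_eq_zero.mp this).resolve_right c.ne_zero
      obtain ⟨g', hg'⟩ := exists_eq_mul_X_sub_C g _ hg
      refine ⟨g', (X - C _) * h, by rw [hgh, hg', mul_assoc], (monic_X_sub_C _).mul hm, ?_,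
        (c * u) * (-a) * (c * u)⁻¹ * y, ?_, ?_⟩
      · rw [(monic_X_sub_C _).natDegree_mul hm, natDegree_X_sub_C, hdeg, add_comm]
      · rw [mul_coeff_zero, hy]
        simp [unitsConj_apply, mul_assoc]
      · rw [map_mul, hξy, map_mul, map_mul, map_inv, pow_succ, mul_comm (ξ (c * u)),
          mul_inv_cancel_right, mul_comm]
  obtain ⟨g, h, hgh, hm, hdeg, y, hy, hξy⟩ := hfac r le_rfl
  have hg1 : g = 1 := by
    have hgm : g.Monic := Monic.of_mul_monic_right hm (hgh ▸ hpm)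
    refine hgm.natDegree_eq_zero.mp ?_
    have := hgm.natDegree_mul hm
    rw [← hgh, hpr, hdeg] at this
    omega
  rw [hg1, one_mul] at hgh
  have hyc : ξ y = 1 := by
    refine hξ y fun x => ?_
    rw [← hy, ← hgh]
    by_cases hx : x = 0
    · simp [hx]
    · have := congrArg (fun q : D[X] => q.coeff 0) (hcent (Units.mk0 x hx))
      simp only [coeff_map, unitsConj_apply, Units.val_inv_eq_inv_val, Units.val_mk0] at this
      exact ((mul_inv_eq_iff_eq_mul₀ hx).mp this).symm
  have hr0 : r ≠ 0 := by
    intro h0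
    have : p = 1 := hpm.natDegree_eq_zero.mp (hpr.trans h0)
    have h2 := hp0 1
    rw [this, eval_one] at h2
    exact one_ne_zero h2
  have hneg : ξ (-1) = 1 := hξ _ fun x => by simp
  have hna : ξ (-a) = ξ a := by rw [← neg_one_mul, map_mul, hneg, one_mul]
  rw [hyc, hna] at hξy
  exact (pow_eq_one_iff_left hr0).mp hξy.symm

end DivisionRing

/-! ### Characters of general linear groups over division algebras -/

section GeneralLinear

open Matrix

variable {D : Type*} [DivisionRing D] {n : ℕ}

theorem vecMulVec_single_mul_apply (k : Fin n) (v : Fin n → D) (g : Matrix (Fin n) (Fin n) D)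
    (i j : Fin n) : (vecMulVec v (Pi.single k 1) * g) i j = v i * g k j := by
  rw [Matrix.mul_apply, Finset.sum_eq_single k]
  · simp [vecMulVec_apply]
  · intro l _ hl
    simp [vecMulVec_apply, hl]
  · simp

theorem vecMulVec_single_mul_self (k : Fin n) (v w : Fin n → D) (hw : w k = 0) :
    (vecMulVec v (Pi.single k 1) : Matrix (Fin n) (Fin n) D) * vecMulVec w (Pi.single k 1) = 0 := by
  ext i j
  rw [vecMulVec_single_mul_apply]
  simp [vecMulVec_apply, hw]

/-- The unipotent matrix obtained from the identity by adding the vector `v`, which vanishes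
at `k`, to the `k`-th column. -/
def columnUnipotent (k : Fin n) (v : Fin n → D) (hv : v k = 0) :
    (Matrix (Fin n) (Fin n) D)ˣ where
  val := 1 + vecMulVec v (Pi.single k 1)
  inv := 1 - vecMulVec v (Pi.single k 1)
  val_inv := by
    rw [add_mul, mul_sub, mul_sub, vecMulVec_single_mul_self k v v hv]
    simp
  inv_val := by
    rw [sub_mul, mul_add, mul_add, vecMulVec_single_mul_self k v v hv]
    simp

theorem columnUnipotent_mul_apply (k : Fin n) (v : Fin n → D) (hv : v k = 0)
    (g : (Matrix (Fin n) (Fin n) D)ˣ) (i j : Fin n) :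
    (columnUnipotent k v hv * g).val i j = g.val i j + v i * g.val k j := by
  change ((1 + vecMulVec v (Pi.single k 1)) * g.val) i j = _
  rw [add_mul, one_mul, Matrix.add_apply, vecMulVec_single_mul_apply]

theorem columnUnipotent_mul (k : Fin n) (v w : Fin n → D) (hv : v k = 0) (hw : w k = 0) :
    columnUnipotent k v hv * columnUnipotent k w hw =
      columnUnipotent k (v + w) (by simp [hv, hw]) := by
  ext1
  change (1 + vecMulVec v (Pi.single k 1)) * (1 + vecMulVec w (Pi.single k 1)) =
    (1 + vecMulVec (v + w) (Pi.single k 1) : Matrix (Fin n) (Fin n) D)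
  rw [add_mul, mul_add, mul_add, vecMulVec_single_mul_self k v w hw, add_vecMulVec]
  simp only [one_mul, mul_one, add_zero]
  abel

/-- The embedding of the diagonal torus `(Dˣ)ⁿ` into `GLₙ(D)`. -/
def diagonalUnits (n : ℕ) (D : Type*) [DivisionRing D] :
    (Fin n → Dˣ) →* (Matrix (Fin n) (Fin n) D)ˣ :=
  (Units.map (diagonalRingHom (Fin n) D : (Fin n → D) →* Matrix (Fin n) (Fin n) D)).comp
    MulEquiv.piUnits.symm.toMonoidHom

theorem diagonalUnits_val (x : Fin n → Dˣ) :
    (diagonalUnits n D x).val = diagonal fun i => (x i : D) := rfl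

theorem diagonalUnits_mul_apply (x : Fin n → Dˣ) (g : (Matrix (Fin n) (Fin n) D)ˣ)
    (i j : Fin n) : (diagonalUnits n D x * g).val i j = x i * g.val i j := by
  rw [Units.val_mul, diagonalUnits_val, diagonal_mul]

variable {C' : Type*} [CommGroup C']

/-- Unipotent elements are killed by every character: multiplication of `v` by a scalar `c` and
by `c - 1` are both effected by conjugation, so that the value at `c v = (c - 1) v + v` is at the
same time the value at `v` and its square. -/
theorem character_columnUnipotent {Q : Type*} [Field Q] [Infinite Q] [Algebra Q D]
    (χ : (Matrix (Fin n) (Fin n) D)ˣ →* C') (k : Fin n) (v : Fin n → D) (hv : v k = 0) :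
    χ (columnUnipotent k v hv) = 1 := by
  have key : ∀ c : Q, c ≠ 0 →
      χ (columnUnipotent k (fun i => algebraMap Q D c * v i) (by simp [hv])) =
        χ (columnUnipotent k v hv) := by
    intro c hc
    let c' : Dˣ := Units.mk0 (algebraMap Q D c) (by simpa using hc)
    let x : Fin n → Dˣ := Function.update (fun _ => c') k 1
    have h : diagonalUnits n D x * columnUnipotent k v hv =
        columnUnipotent k (fun i => algebraMap Q D c * v i) (by simp [hv]) *
          diagonalUnits n D x := by
      ext i j
      rw [diagonalUnits_mul_apply, columnUnipotent_mul_apply, diagonalUnits_val]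
      change (x i : D) * ((1 : Matrix (Fin n) (Fin n) D) i j + vecMulVec v (Pi.single k 1) i j) = _
      by_cases hjk : j = k
      · subst hjk
        by_cases hij : i = j
        · subst hij
          simp [vecMulVec_apply, hv]
        · simp [vecMulVec_apply, x, hij, c']
      · by_cases hij : i = j
        · subst hij
          simp [vecMulVec_apply, hjk, Ne.symm hjk]
        · simp [vecMulVec_apply, hij, hjk, Ne.symm hjk]
    have := congrArg χ h
    rw [map_mul, map_mul, mul_comm] at this
    exact (mul_right_cancel this).symm
  classical
  obtain ⟨c, hc⟩ := Infinite.exists_notMem_finset ({0, 1} : Finset Q)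
  simp only [Finset.mem_insert, Finset.mem_singleton, not_or] at hc
  have h1 := key c hc.1
  have h2 : columnUnipotent k (fun i => algebraMap Q D c * v i) (by simp [hv]) =
      columnUnipotent k (fun i => algebraMap Q D (c - 1) * v i) (by simp [hv]) *
        columnUnipotent k v hv := by
    rw [columnUnipotent_mul]
    congr 1
    ext i
    simp [sub_mul]
  rw [h2, map_mul, key (c - 1) (sub_ne_zero.mpr hc.2)] at h1
  simpa using h1

/-- Gaussian elimination: a character of `GLₙ(D)` that is trivial on column unipotents and on
diagonal matrices is trivial. -/
theorem character_eq_one_of_unipotent_of_diagonal (χ : (Matrix (Fin n) (Fin n) D)ˣ →* C')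
    (hu : ∀ k v hv, χ (columnUnipotent k v hv) = 1) (hd : ∀ x, χ (diagonalUnits n D x) = 1)
    (g : (Matrix (Fin n) (Fin n) D)ˣ) : χ g = 1 := by
  -- `m` columns are still to be cleared
  have key : ∀ m k : ℕ, k + m = n → ∀ g : (Matrix (Fin n) (Fin n) D)ˣ,
      (∀ i j : Fin n, j.val < k → g.val i j = (1 : Matrix (Fin n) (Fin n) D) i j) → χ g = 1 := by
    intro m
    induction m with
    | zero =>
      intro k hk g hg
      have : g = 1 := by
        ext i j
        exact hg i j (by omega)
      rw [this, map_one]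
    | succ m ih =>
      intro k0 hk g hg
      let k : Fin n := ⟨k0, by omega⟩
      have hrow : ∀ (i j : Fin n), k ≤ i → j.val < k0 → g.val i j = 0 := by
        intro i j hi hj
        rw [hg i j hj, Matrix.one_apply_ne]
        rintro rfl
        exact absurd (Fin.le_def.mp hi) (by simp [k, hj])
      have main : ∀ g : (Matrix (Fin n) (Fin n) D)ˣ,
          (∀ i j : Fin n, j.val < k0 → g.val i j = (1 : Matrix (Fin n) (Fin n) D) i j) →
          g.val k k ≠ 0 → χ g = 1 := by
        intro g hg hkk
        have hrk : ∀ j : Fin n, j.val < k0 → g.val k j = 0 := by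
          intro j hj
          rw [hg k j hj, Matrix.one_apply_ne]
          rintro rfl
          exact absurd hj (by simp [k])
        let v : Fin n → D := Function.update (fun i => -(g.val i k * (g.val k k)⁻¹)) k 0
        have hv : v k = 0 := by simp [v]
        let x : Fin n → Dˣ := Pi.mulSingle k (Units.mk0 _ hkk)⁻¹
        have := ih (k0 + 1) (by omega) (diagonalUnits n D x * (columnUnipotent k v hv * g)) ?_
        · rwa [map_mul, map_mul, hu, hd, one_mul, one_mul] at this
        · intro i j hj
          rw [diagonalUnits_mul_apply, columnUnipotent_mul_apply]
          rcases Nat.lt_succ_iff_lt_or_eq.mp hj with hj | hj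
          · rw [hrk j hj, mul_zero, add_zero, hg i j hj]
            by_cases hik : i = k
            · have : i ≠ j := by
                rintro rfl
                rw [hik] at hj
                exact absurd hj (by simp [k])
              simp [this]
            · simp [x, hik]
          · have hjk : j = k := Fin.ext hj
            subst hjk
            by_cases hik : i = k
            · rw [hik, hv]
              simp [x, hkk]
            · simp [x, hik, v, hkk]
      by_cases hkk : g.val k k = 0
      · obtain ⟨i, hki, hi⟩ : ∃ i : Fin n, k ≤ i ∧ g.val i k ≠ 0 := by
          by_contra! hcon
          have hinv : ∀ i j : Fin n, j.val < k0 →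
              (g⁻¹).val i j = (1 : Matrix (Fin n) (Fin n) D) i j := by
            intro i j hj
            have h1 : ((g⁻¹).val * g.val) i j = (1 : Matrix (Fin n) (Fin n) D) i j := by
              rw [Units.inv_mul]
            rw [← h1, Matrix.mul_apply, Finset.sum_eq_single j]
            · simp [hg j j hj]
            · intro l _ hl
              rw [hg l j hj, Matrix.one_apply_ne hl, mul_zero]
            · simp
          have h1 : ((g⁻¹).val * g.val) k k = 1 := by
            rw [Units.inv_mul, Matrix.one_apply_eq]
          rw [Matrix.mul_apply, Finset.sum_eq_zero] at h1
          · exact zero_ne_one h1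
          · intro l _
            by_cases hl : k ≤ l
            · rw [hcon l hl, mul_zero]
            · rw [hinv k l (by simpa [Fin.le_def, k] using hl), Matrix.one_apply_ne, zero_mul]
              rintro rfl
              exact hl le_rfl
        have hik : i ≠ k := by
          rintro rfl
          exact hi hkk
        have hv : (Pi.single k 1 : Fin n → D) i = 0 := by simp [hik]
        have := main (columnUnipotent i (Pi.single k 1) hv * g) ?_ ?_
        · rwa [map_mul, hu, one_mul] at this
        · intro a b hb
          rw [columnUnipotent_mul_apply, hrow i b hki hb, mul_zero, add_zero, hg a b hb]
        · rw [columnUnipotent_mul_apply, hkk]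
          simpa using hi
      · exact main g hg hkk
  exact key n 0 (by simp) g (by simp)

/-- Permutation matrices conjugate the diagonal entries into each other. -/
theorem character_diagonalUnits_mulSingle (χ : (Matrix (Fin n) (Fin n) D)ˣ →* C')
    (k l : Fin n) (x : Dˣ) :
    χ (diagonalUnits n D (Pi.mulSingle k x)) = χ (diagonalUnits n D (Pi.mulSingle l x)) := by
  let σ := Equiv.swap k l
  let P : Matrix (Fin n) (Fin n) D := σ.toPEquiv.toMatrix
  have hP : P * P = 1 := by
    rw [PEquiv.toMatrix_toPEquiv_mul]
    ext i j
    simp [P, σ, Matrix.one_apply]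
  let p : (Matrix (Fin n) (Fin n) D)ˣ := ⟨P, P, hP, hP⟩
  have h : p * diagonalUnits n D (Pi.mulSingle k x) = diagonalUnits n D (Pi.mulSingle l x) * p := by
    ext i j
    rw [diagonalUnits_mul_apply]
    change (P * (diagonalUnits n D (Pi.mulSingle k x)).val) i j = _ * P i j
    rw [PEquiv.toMatrix_toPEquiv_mul, diagonalUnits_val]
    simp only [submatrix_apply, id, P, PEquiv.toMatrix_toPEquiv_apply]
    by_cases hij : σ i = j
    · subst hij
      have : (Pi.mulSingle k x : Fin n → Dˣ) (σ i) = (Pi.mulSingle l x : Fin n → Dˣ) i := by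
        simp only [Pi.mulSingle_apply, σ, Equiv.swap_apply_eq_iff, Equiv.swap_apply_left]
      simp [this]
    · simp [hij, Ne.symm hij]
  have := congrArg χ h
  rw [map_mul, map_mul, mul_comm] at this
  exact mul_right_cancel this

theorem matrix_character_eq_one {Q : Type*} [Field Q] [Infinite Q] [Algebra Q D]
    [Algebra.IsIntegral Q D] [IsMulTorsionFree C'] (χ : (Matrix (Fin n) (Fin n) D)ˣ →* C')
    (hχ : ∀ z : (Matrix (Fin n) (Fin n) D)ˣ, (∀ x, z.val * x = x * z.val) → χ z = 1)
    (g : (Matrix (Fin n) (Fin n) D)ˣ) : χ g = 1 := by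
  refine character_eq_one_of_unipotent_of_diagonal χ
    (character_columnUnipotent (Q := Q) χ) ?_ g
  have h1 : χ.comp (diagonalUnits n D) = ∏ i : Fin n,
      ((χ.comp (diagonalUnits n D)).comp (MonoidHom.mulSingle (fun _ => Dˣ) i)).comp
        (Pi.evalMonoidHom (fun _ => Dˣ) i) := by
    refine MonoidHom.pi_ext fun i x => ?_
    rw [MonoidHom.finsetProd_apply, Finset.prod_eq_single i]
    · simp
    · intro j _ hj
      simp [hj]
    · simp
  have h1' : ∀ x, χ (diagonalUnits n D x) =
      ∏ i : Fin n, χ (diagonalUnits n D (Pi.mulSingle i (x i))) := by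
    intro x
    have := DFunLike.congr_fun h1 x
    rwa [MonoidHom.finsetProd_apply] at this
  have h2 : ∀ (i : Fin n) (x : Dˣ), χ (diagonalUnits n D (Pi.mulSingle i x)) = 1 := by
    intro i x
    refine divisionAlgebra_character_eq_one (Q := Q)
      ((χ.comp (diagonalUnits n D)).comp (MonoidHom.mulSingle (fun _ => Dˣ) i)) (fun z hz => ?_) x
    have h3 : χ (diagonalUnits n D fun _ => z) = 1 := by
      refine hχ _ fun y => ?_
      ext a b
      rw [diagonalUnits_val, diagonal_mul, mul_diagonal, hz]
    have h4 := h1' fun _ => z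
    rw [h3,
      Finset.prod_congr rfl fun j _ => character_diagonalUnits_mulSingle χ j i z,
      Finset.prod_const, Finset.card_univ, Fintype.card_fin] at h4
    exact (pow_eq_one_iff_left (Nat.ne_of_gt i.pos)).mp h4.symm
  intro x
  rw [h1', Finset.prod_eq_one fun i _ => h2 i (x i)]

end GeneralLinear

/-! ### Characters of semisimple algebras -/

/-- A character of the unit group of a finite dimensional semisimple algebra over an infinite
field, with values in a torsion-free group, is trivial as soon as it is trivial on the center. -/
theorem semisimple_character_eq_one {Q B C' : Type*} [Field Q] [Infinite Q] [Ring B] [Algebra Q B]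
    [FiniteDimensional Q B] [IsSemisimpleRing B] [CommGroup C'] [IsMulTorsionFree C']
    (χ : Bˣ →* C') (hχ : ∀ z : Bˣ, (∀ x, z.val * x = x * z.val) → χ z = 1) (b : Bˣ) :
    χ b = 1 := by
  classical
  obtain ⟨n, D, d, _, _, _, _, ⟨e⟩⟩ :=
    IsSemisimpleRing.exists_algEquiv_pi_matrix_divisionRing_finite Q B
  let E : Bˣ ≃* ∀ i, (Matrix (Fin (d i)) (Fin (d i)) (D i))ˣ :=
    (Units.mapEquiv e.toMulEquiv).trans MulEquiv.piUnits
  have h1 : χ.comp E.symm.toMonoidHom = 1 := by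
    refine MonoidHom.pi_ext fun i x => ?_
    refine matrix_character_eq_one (Q := Q)
      ((χ.comp E.symm.toMonoidHom).comp (MonoidHom.mulSingle
        (fun i => (Matrix (Fin (d i)) (Fin (d i)) (D i))ˣ) i)) (fun z hz => ?_) x
    refine hχ _ fun y => ?_
    apply e.injective
    rw [map_mul, map_mul]
    let z' : ∀ j, (Matrix (Fin (d j)) (Fin (d j)) (D j))ˣ := Pi.mulSingle i z
    have h2 : e (E.symm z').val = fun j => (z' j).val := by
      change e (e.symm _) = _
      rw [e.apply_symm_apply]
      rfl
    change e (E.symm z').val * _ = _ * e (E.symm z').val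
    rw [h2]
    ext1 j
    by_cases hj : j = i
    · subst hj
      simp [z', hz]
    · simp [z', hj]
  have := DFunLike.congr_fun h1 (E b)
  simpa using this

/-! ### Generalized indices of commensurable subgroups -/

section RelIndexRatio

variable {X Y : Type*} [Group X] [Group Y]

/-- The generalized index `[H : K] = (H : H ∩ K) / (K : H ∩ K)` of two commensurable subgroups. -/
noncomputable def relIndexRatio (H K : Subgroup X) : ℚ :=
  (K.relIndex H : ℚ) / (H.relIndex K : ℚ)

theorem relIndexRatio_eq {H K W : Subgroup X} (hH : W ≤ H) (hK : W ≤ K)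
    (h₁ : W.relIndex H ≠ 0) :
    relIndexRatio H K = (W.relIndex H : ℚ) / (W.relIndex K : ℚ) := by
  have e1 := Subgroup.relIndex_mul_relIndex W (H ⊓ K) H (le_inf hH hK) inf_le_left
  have e2 := Subgroup.relIndex_mul_relIndex W (H ⊓ K) K (le_inf hH hK) inf_le_right
  rw [Subgroup.inf_relIndex_left] at e1
  rw [Subgroup.inf_relIndex_right] at e2
  have h3 : (W.relIndex (H ⊓ K) : ℚ) ≠ 0 := by
    intro h
    rw [Nat.cast_eq_zero.mp h, zero_mul] at e1
    exact h₁ e1.symm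
  rw [relIndexRatio, ← e1, ← e2, Nat.cast_mul, Nat.cast_mul, mul_div_mul_left _ _ h3]

theorem relIndexRatio_self (H : Subgroup X) : relIndexRatio H H = 1 := by
  simp [relIndexRatio]

theorem relIndexRatio_mul {H K J : Subgroup X} (hHK : H.Commensurable K) (hKJ : K.Commensurable J) :
    relIndexRatio H K * relIndexRatio K J = relIndexRatio H J := by
  have hHJ := hHK.trans hKJ
  have hWH : (H ⊓ (K ⊓ J)).relIndex H ≠ 0 := by
    rw [Subgroup.inf_relIndex_left]
    exact Subgroup.relIndex_inf_ne_zero hHK.2 hHJ.2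
  have hWK : (H ⊓ (K ⊓ J)).relIndex K ≠ 0 := by
    rw [inf_left_comm, Subgroup.inf_relIndex_left]
    exact Subgroup.relIndex_inf_ne_zero hHK.1 hKJ.2
  rw [relIndexRatio_eq (W := H ⊓ (K ⊓ J)) inf_le_left (inf_le_right.trans inf_le_left) hWH,
    relIndexRatio_eq (W := H ⊓ (K ⊓ J)) (inf_le_right.trans inf_le_left)
      (inf_le_right.trans inf_le_right) hWK,
    relIndexRatio_eq (W := H ⊓ (K ⊓ J)) inf_le_left (inf_le_right.trans inf_le_right) hWH]
  exact div_mul_div_cancel₀ (by exact_mod_cast hWK)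

theorem relIndexRatio_pos {H K : Subgroup X} (h : H.Commensurable K) : 0 < relIndexRatio H K :=
  div_pos (by exact_mod_cast Nat.pos_of_ne_zero h.2) (by exact_mod_cast Nat.pos_of_ne_zero h.1)

theorem relIndexRatio_map {f : X →* Y} (hf : Function.Injective f) (H K : Subgroup X) :
    relIndexRatio (H.map f) (K.map f) = relIndexRatio H K := by
  simp only [relIndexRatio, Subgroup.relIndex_map_map_of_injective _ _ hf]

/-- If a group `G` acts on `X` by automorphisms that move a subgroup `Γ` to commensurable
subgroups, then `b ↦ [b Γ : Γ]` is a homomorphism. -/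
noncomputable def relIndexCharacter {G : Type*} [Group G] (α : G →* MulAut X) (Γ : Subgroup X)
    (hΓ : ∀ b, (Γ.map (α b).toMonoidHom).Commensurable Γ) : G →* {q : ℚ // 0 < q} where
  toFun b := ⟨relIndexRatio (Γ.map (α b).toMonoidHom) Γ, relIndexRatio_pos (hΓ b)⟩
  map_one' := by
    ext
    have : Γ.map ((α 1).toMonoidHom) = Γ := by
      rw [map_one]
      exact Subgroup.map_id Γ
    change relIndexRatio (Γ.map (α 1).toMonoidHom) Γ = 1
    rw [this, relIndexRatio_self]
  map_mul' b c := by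
    ext
    have h1 : Γ.map (α (b * c)).toMonoidHom =
        (Γ.map (α c).toMonoidHom).map (α b).toMonoidHom := by
      rw [Subgroup.map_map, map_mul]
      rfl
    have h2 : ((Γ.map (α c).toMonoidHom).map (α b).toMonoidHom).Commensurable
        (Γ.map (α b).toMonoidHom) := by
      have hinj : Function.Injective (α b).toMonoidHom := (α b).injective
      exact ⟨by rw [Subgroup.relIndex_map_map_of_injective _ _ hinj]; exact (hΓ c).1,
        by rw [Subgroup.relIndex_map_map_of_injective _ _ hinj]; exact (hΓ c).2⟩
    change relIndexRatio _ _ = relIndexRatio _ _ * relIndexRatio _ _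
    rw [h1, ← relIndexRatio_mul h2 (hΓ b), relIndexRatio_map (α b).injective, mul_comm]

/-- A subgroup that is commensurable to all its images under the unit group of a semisimple
algebra has the same size as these, provided that the central units act trivially. -/
theorem relIndexRatio_map_semisimple {Q B : Type*} [Field Q] [Infinite Q] [Ring B] [Algebra Q B]
    [FiniteDimensional Q B] [IsSemisimpleRing B] (α : Bˣ →* MulAut X) (Γ : Subgroup X)
    (hΓ : ∀ b, (Γ.map (α b).toMonoidHom).Commensurable Γ)
    (hα : ∀ z : Bˣ, (∀ x, z.val * x = x * z.val) → α z = 1) (b : Bˣ) :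
    relIndexRatio (Γ.map (α b).toMonoidHom) Γ = 1 := by
  refine congrArg Subtype.val
    (semisimple_character_eq_one (Q := Q) (relIndexCharacter α Γ hΓ) (fun z hz => ?_) b)
  ext
  change relIndexRatio (Γ.map (α z).toMonoidHom) Γ = 1
  have : Γ.map ((α z).toMonoidHom) = Γ := by
    rw [hα z hz]
    exact Subgroup.map_id Γ
  rw [this, relIndexRatio_self]

end RelIndexRatio

/-! ### Indices of correspondences of groups -/

section Correspondence

theorem relIndex_sup_of_normal_right {X : Type*} [Group X] (H K : Subgroup X) [K.Normal] :
    H.relIndex (H ⊔ K) = H.relIndex K := by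
  refine (Nat.card_eq_of_bijective
    (Subgroup.quotientSubgroupOfEmbeddingOfLE H (le_sup_right : K ≤ H ⊔ K))
    ⟨(Subgroup.quotientSubgroupOfEmbeddingOfLE H le_sup_right).injective, ?_⟩).symm
  intro q
  obtain ⟨⟨x, hx⟩, rfl⟩ := QuotientGroup.mk_surjective q
  rw [sup_comm] at hx
  obtain ⟨k, hk, h, hh, rfl⟩ := Subgroup.mem_sup_of_normal_left.mp hx
  refine ⟨QuotientGroup.mk ⟨k, hk⟩, ?_⟩
  rw [Subgroup.quotientSubgroupOfEmbeddingOfLE_apply_mk, QuotientGroup.eq]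
  simpa [Subgroup.mem_subgroupOf] using hh

variable {W W' H G X Y : Type*} [Group W] [Group W'] [Group H] [Group G] [Group X] [Group Y]

theorem card_ker_comp (f : W →* H) (ρ : H →* X) :
    Nat.card f.ker * Nat.card (f.range ⊓ ρ.ker : Subgroup H) = Nat.card (ρ.comp f).ker := by
  have h1 := Subgroup.relIndex_mul_relIndex (⊥ : Subgroup W) f.ker (ρ.comp f).ker bot_le
    (fun x hx => by simpa using congrArg ρ (MonoidHom.mem_ker.mp hx))
  rw [Subgroup.relIndex_bot_left, Subgroup.relIndex_bot_left, Subgroup.relIndex_ker,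
    ← MonoidHom.comap_ker, Subgroup.map_comap_eq] at h1
  exact h1

theorem range_comp_relIndex_mul (f : W →* H) (ρ : H →* X) :
    (ρ.comp f).range.relIndex ρ.range * f.range.relIndex ρ.ker = f.range.index := by
  have h1 := Subgroup.relIndex_map_map ρ f.range ⊤
  rw [← MonoidHom.range_comp, ← MonoidHom.range_eq_map, top_sup_eq,
    Subgroup.relIndex_top_right] at h1
  rw [h1, ← relIndex_sup_of_normal_right, mul_comm]
  exact Subgroup.relIndex_mul_index le_sup_left

/-- The index of an isogeny `f`, read off from the images and kernels of `ρ` and `ρ ∘ f`. -/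
theorem groupIsogenyIndex_eq (f : W →* H) (ρ : H →* X) [Finite ρ.ker] (hf : IsGroupIsogeny f) :
    groupIsogenyIndex f =
      ((ρ.comp f).range.relIndex ρ.range : ℚ) * Nat.card ρ.ker / Nat.card (ρ.comp f).ker := by
  have := hf.1
  have h2 := Subgroup.relIndex_mul_relIndex (⊥ : Subgroup H) (f.range ⊓ ρ.ker) ρ.ker bot_le
    inf_le_right
  rw [Subgroup.relIndex_bot_left, Subgroup.relIndex_bot_left, Subgroup.inf_relIndex_right] at h2
  have h3 : (Nat.card (f.range ⊓ ρ.ker : Subgroup H) : ℚ) ≠ 0 := by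
    intro h
    rw [Nat.cast_eq_zero.mp h, zero_mul] at h2
    exact Nat.card_pos.ne h2
  have h4 : (Nat.card f.ker : ℚ) ≠ 0 := by exact_mod_cast Nat.card_pos.ne'
  rw [groupIsogenyIndex, ← range_comp_relIndex_mul f ρ, ← card_ker_comp f ρ, ← h2]
  push_cast
  field_simp

theorem relIndex_range_ne_zero (f : W →* H) (ρ : H →* X) (hf : IsGroupIsogeny f) :
    (ρ.comp f).range.relIndex ρ.range ≠ 0 := by
  intro h
  have := range_comp_relIndex_mul f ρ
  rw [h, zero_mul] at this
  exact hf.2.index_ne_zero this.symm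

theorem commensurable_of_isGroupIsogeny (f : W →* H) (g : W →* G) (hf : IsGroupIsogeny f)
    (hg : IsGroupIsogeny g) (ρ : H →* X) (σ : G →* Y) (Φ : X ≃* Y)
    (h : σ.comp g = Φ.toMonoidHom.comp (ρ.comp f)) :
    σ.range.Commensurable (ρ.range.map Φ.toMonoidHom) := by
  have h1 : (σ.comp g).range.relIndex σ.range ≠ 0 := relIndex_range_ne_zero g σ hg
  have h2 : (σ.comp g).range.relIndex (ρ.range.map Φ.toMonoidHom) ≠ 0 := by
    rw [h, MonoidHom.range_comp, Subgroup.relIndex_map_map_of_injective _ _ Φ.injective]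
    exact relIndex_range_ne_zero f ρ hf
  have h3 : (σ.comp g).range ≤ σ.range := by
    rw [MonoidHom.range_comp]
    exact Subgroup.map_le_range σ g.range
  have h4 : (σ.comp g).range ≤ ρ.range.map Φ.toMonoidHom := by
    rw [h, MonoidHom.range_comp, MonoidHom.range_comp]
    exact Subgroup.map_mono (Subgroup.map_le_range ρ f.range)
  exact ⟨fun h0 => h2 (Subgroup.relIndex_eq_zero_of_le_left h3 h0),
    fun h0 => h1 (Subgroup.relIndex_eq_zero_of_le_left h4 h0)⟩

/-- If the correspondence `(W, f, g)` from `H` to `G` induces the isomorphism `Φ` on the targets of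
`ρ` and `σ`, then its index is `[σ G : Φ ρ H]` up to a factor that depends only on `ρ` and `σ`. -/
theorem groupIsogenyIndex_div (f : W →* H) (g : W →* G) (hf : IsGroupIsogeny f)
    (hg : IsGroupIsogeny g) (ρ : H →* X) (σ : G →* Y) [Finite ρ.ker] [Finite σ.ker] (Φ : X ≃* Y)
    (h : σ.comp g = Φ.toMonoidHom.comp (ρ.comp f)) :
    groupIsogenyIndex g / groupIsogenyIndex f =
      relIndexRatio σ.range (ρ.range.map Φ.toMonoidHom) * (Nat.card σ.ker / Nat.card ρ.ker) := by
  have h1 : (σ.comp g).range.relIndex σ.range ≠ 0 := relIndex_range_ne_zero g σ hg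
  have h3 : (σ.comp g).range ≤ σ.range := by
    rw [MonoidHom.range_comp]
    exact Subgroup.map_le_range σ g.range
  have h4 : (σ.comp g).range ≤ ρ.range.map Φ.toMonoidHom := by
    rw [h, MonoidHom.range_comp, MonoidHom.range_comp]
    exact Subgroup.map_mono (Subgroup.map_le_range ρ f.range)
  have h5 : (σ.comp g).ker = (ρ.comp f).ker := by
    ext x
    rw [h]
    simp [MonoidHom.mem_ker]
  have h6 : (σ.comp g).range.relIndex (ρ.range.map Φ.toMonoidHom) =
      (ρ.comp f).range.relIndex ρ.range := by
    rw [h, MonoidHom.range_comp, Subgroup.relIndex_map_map_of_injective _ _ Φ.injective]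
  have h7 : (Nat.card (ρ.comp f).ker : ℚ) ≠ 0 := by
    have := hf.1
    rw [← card_ker_comp]
    have h8 : Finite (f.range ⊓ ρ.ker : Subgroup H) :=
      Finite.of_injective _ (Subgroup.inclusion_injective
        (inf_le_right : f.range ⊓ ρ.ker ≤ ρ.ker))
    exact_mod_cast (Nat.mul_pos Nat.card_pos Nat.card_pos).ne'
  have h8 : (Nat.card ρ.ker : ℚ) ≠ 0 := by exact_mod_cast Nat.card_pos.ne'
  rw [groupIsogenyIndex_eq g σ hg, groupIsogenyIndex_eq f ρ hf, relIndexRatio_eq h3 h4 h1, h6, h5]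
  have h9 : ((ρ.comp f).range.relIndex ρ.range : ℚ) ≠ 0 := by
    exact_mod_cast relIndex_range_ne_zero f ρ hf
  field_simp

/-- Two correspondences between the same groups have the same index if the automorphism by which
the induced isomorphisms differ preserves the size of the image of the source. -/
theorem groupIsogenyIndex_div_eq (f : W →* H) (g : W →* G) (hf : IsGroupIsogeny f)
    (hg : IsGroupIsogeny g) (f' : W' →* H) (g' : W' →* G) (hf' : IsGroupIsogeny f')
    (hg' : IsGroupIsogeny g') (ρ : H →* X) (σ : G →* Y) [Finite ρ.ker] [Finite σ.ker]
    (Φ Φ' : X ≃* Y) (h : σ.comp g = Φ.toMonoidHom.comp (ρ.comp f))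
    (h' : σ.comp g' = Φ'.toMonoidHom.comp (ρ.comp f'))
    (hr : relIndexRatio (ρ.range.map (Φ.trans Φ'.symm).toMonoidHom) ρ.range = 1) :
    groupIsogenyIndex g / groupIsogenyIndex f = groupIsogenyIndex g' / groupIsogenyIndex f' := by
  rw [groupIsogenyIndex_div f g hf hg ρ σ Φ h, groupIsogenyIndex_div f' g' hf' hg' ρ σ Φ' h',
    ← relIndexRatio_mul (commensurable_of_isGroupIsogeny f g hf hg ρ σ Φ h)
      ((commensurable_of_isGroupIsogeny f g hf hg ρ σ Φ h).symm.trans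
        (commensurable_of_isGroupIsogeny f' g' hf' hg' ρ σ Φ' h'))]
  have h1 : ρ.range.map Φ.toMonoidHom =
      (ρ.range.map (Φ.trans Φ'.symm).toMonoidHom).map Φ'.toMonoidHom := by
    rw [Subgroup.map_map]
    congr 1
    ext x
    simp
  rw [h1, relIndexRatio_map Φ'.injective, hr, mul_one]

end Correspondence

/-! ### Finiteness of quotients `X / mX` -/

section FiniteRank

variable {Z : Type*} [CommRing Z]

/-- Finiteness of `X / mX`, expressed by a finite set of representatives. -/
def FiniteMod (m : Z) (X : Type*) [AddCommGroup X] [Module Z X] : Prop :=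
  ∃ S : Set X, S.Finite ∧ ∀ x, ∃ s ∈ S, ∃ y, x = s + m • y

theorem FiniteMod.of_surjective {m : Z} {X Y : Type*} [AddCommGroup X] [Module Z X]
    [AddCommGroup Y] [Module Z Y] (h : FiniteMod m X) (f : X →ₗ[Z] Y)
    (hf : Function.Surjective f) : FiniteMod m Y := by
  obtain ⟨S, hS, h⟩ := h
  refine ⟨f '' S, hS.image f, fun y => ?_⟩
  obtain ⟨x, rfl⟩ := hf y
  obtain ⟨s, hs, y, rfl⟩ := h x
  exact ⟨f s, ⟨s, hs, rfl⟩, f y, by simp⟩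

theorem FiniteMod.of_finite (m : Z) (X : Type*) [AddCommGroup X] [Module Z X] [Finite X] :
    FiniteMod m X :=
  ⟨Set.univ, Set.finite_univ, fun x => ⟨x, trivial, 0, by simp⟩⟩

theorem FiniteMod.of_ker_of_range {m : Z} {X Y : Type*} [AddCommGroup X] [Module Z X]
    [AddCommGroup Y] [Module Z Y] (f : X →ₗ[Z] Y) (h₁ : FiniteMod m (LinearMap.ker f))
    (h₂ : FiniteMod m (LinearMap.range f)) : FiniteMod m X := by
  obtain ⟨S, hS, h₁⟩ := h₁
  obtain ⟨T, hT, h₂⟩ := h₂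
  choose g hg using fun t : LinearMap.range f => t.2
  refine ⟨_, (hS.prod hT).image fun p => (p.1 : X) + g p.2, fun x => ?_⟩
  obtain ⟨t, ht, ⟨y, ⟨z, rfl⟩⟩, hy⟩ := h₂ ⟨f x, x, rfl⟩
  have hy' : f x = t + m • f z := congrArg Subtype.val hy
  obtain ⟨s, hs, w, hw⟩ := h₁ ⟨x - g t - m • z, by
    rw [LinearMap.mem_ker, map_sub, map_sub, map_smul, hg, hy']
    abel⟩
  refine ⟨_, ⟨(s, t), ⟨hs, ht⟩, rfl⟩, z + w, ?_⟩
  have hw' : x - g t - m • z = s + m • (w : X) := congrArg Subtype.val hw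
  rw [smul_add, ← sub_eq_zero]
  have := sub_eq_zero.mpr hw'
  rw [← this]
  dsimp only
  abel

theorem FiniteMod.finiteIndex {m : Z} {X : Type*} [AddCommGroup X] [Module Z X]
    (h : FiniteMod m X) (K : AddSubgroup X) (hK : ∀ x : X, m • x ∈ K) : K.FiniteIndex := by
  obtain ⟨S, hS, h⟩ := h
  have := hS.to_subtype
  have : Finite (X ⧸ K) := by
    refine Finite.of_surjective (fun s : S => QuotientAddGroup.mk (s : X)) fun q => ?_
    obtain ⟨x, rfl⟩ := QuotientAddGroup.mk_surjective q
    obtain ⟨s, hs, y, rfl⟩ := h x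
    exact ⟨⟨s, hs⟩, by rw [QuotientAddGroup.eq]; simpa using hK y⟩
  exact AddSubgroup.finiteIndex_of_finite_quotient

/-- There are finitely many homomorphisms `X → Y` killed by `m` if `X / mX` and `Y[m]` are
finite. -/
theorem FiniteMod.finite_linearMap {R : Type*} [Ring R] [Algebra Z R] {m : Z} {X Y : Type*}
    [AddCommGroup X] [Module Z X] [Module R X] [IsScalarTower Z R X] [AddCommGroup Y] [Module Z Y]
    [Module R Y] [IsScalarTower Z R Y] (h : FiniteMod m X) (hY : {y : Y | m • y = 0}.Finite) :
    {ν : X →ₗ[R] Y | m • ν = 0}.Finite := by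
  obtain ⟨S, hS, h⟩ := h
  have := hS.to_subtype
  have := hY.to_subtype
  rw [← Set.finite_coe_iff]
  refine Finite.of_injective (β := S → {y : Y | m • y = 0})
    (fun ν s => ⟨ν.1 s, LinearMap.congr_fun ν.2 s⟩) fun ν ν' hν => ?_
  ext x
  obtain ⟨s, hs, y, rfl⟩ := h x
  have h1 : ν.1 s = ν'.1 s := congrArg Subtype.val (congrFun hν ⟨s, hs⟩)
  have h2 : ∀ ν : {ν : X →ₗ[R] Y | m • ν = 0}, ν.1 (m • y) = 0 := fun ν =>
    (LinearMap.map_smul_of_tower ν.1 m y).trans (LinearMap.congr_fun ν.2 y)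
  rw [map_add, map_add, h1, h2, h2]

theorem finite_quotient_ideal (hZ : ∀ m : Z, m ≠ 0 → Finite (Z ⧸ Ideal.span {m}))
    (J : Ideal Z) (hJ : J ≠ ⊥) : J.toAddSubgroup.index ≠ 0 := by
  obtain ⟨a, ha, ha0⟩ := Submodule.exists_mem_ne_zero_of_ne_bot hJ
  have := hZ a ha0
  have hfi : (Ideal.span {a}).toAddSubgroup.FiniteIndex :=
    @AddSubgroup.finiteIndex_of_finite_quotient _ _ _ this
  have hle : (Ideal.span {a}).toAddSubgroup ≤ J.toAddSubgroup :=
    (Ideal.span_singleton_le_iff_mem J).mpr ha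
  exact (AddSubgroup.finiteIndex_of_le hle).index_ne_zero

variable [IsDomain Z]

/-- A non-zero ideal `I` satisfies `(I : mI) = (Z : mZ)`: both sides become `(Z : mI)` after
multiplication by the finite index `(Z : I) = (mZ : mI)`. -/
theorem ideal_relIndex (hZ : ∀ m : Z, m ≠ 0 → Finite (Z ⧸ Ideal.span {m})) {m : Z} (hm : m ≠ 0)
    (I : Ideal Z) (hI : I ≠ ⊥) :
    (I.toAddSubgroup.map (AddMonoidHom.mulLeft m)).relIndex I.toAddSubgroup =
      (Ideal.span {m}).toAddSubgroup.index := by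
  have h1 := AddSubgroup.relIndex_mul_index
    (show I.toAddSubgroup.map (AddMonoidHom.mulLeft m) ≤ I.toAddSubgroup by
      rintro _ ⟨x, hx, rfl⟩
      exact I.mul_mem_left m hx)
  have h2 := AddSubgroup.relIndex_mul_index (AddSubgroup.map_mono
    (f := AddMonoidHom.mulLeft m) (le_top : I.toAddSubgroup ≤ ⊤))
  rw [AddSubgroup.relIndex_map_map_of_injective _ _ (mul_right_injective₀ hm),
    AddSubgroup.relIndex_top_right] at h2
  have h3 : (⊤ : AddSubgroup Z).map (AddMonoidHom.mulLeft m) =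
      (Ideal.span {m}).toAddSubgroup := by
    ext x
    constructor
    · rintro ⟨y, -, rfl⟩
      exact Ideal.mem_span_singleton.mpr ⟨y, rfl⟩
    · intro hx
      obtain ⟨y, rfl⟩ := Ideal.mem_span_singleton.mp hx
      exact ⟨y, trivial, rfl⟩
  rw [h3, mul_comm, ← h1] at h2
  exact (Nat.eq_of_mul_eq_mul_right (Nat.pos_of_ne_zero (finite_quotient_ideal hZ I hI)) h2).symm

variable {Q : Type*} [Field Q] [Algebra Z Q] [IsFractionRing Z Q]

/-- A subgroup `J` of `Q` has at most `#(Z/mZ)` classes modulo `m`: representatives of finitely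
many classes generate a `Z`-submodule that is isomorphic to an ideal. -/
theorem finiteMod_submodule_fractionRing (hZ : ∀ m : Z, m ≠ 0 → Finite (Z ⧸ Ideal.span {m}))
    {m : Z} (hm : m ≠ 0) (J : Submodule Z Q) : FiniteMod m J := by
  classical
  suffices hfin : Finite (J ⧸ LinearMap.range (LinearMap.lsmul Z J m)) by
    refine ⟨_, Set.finite_range
      (fun q : J ⧸ LinearMap.range (LinearMap.lsmul Z J m) => q.out), fun x => ?_⟩
    refine ⟨_, ⟨Submodule.Quotient.mk x, rfl⟩, ?_⟩
    have h1 : x - (Submodule.Quotient.mk (p := LinearMap.range (LinearMap.lsmul Z J m)) x).out ∈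
        LinearMap.range (LinearMap.lsmul Z J m) := by
      rw [← Submodule.Quotient.eq]
      exact (Quotient.out_eq _).symm
    obtain ⟨y, hy⟩ := h1
    exact ⟨y, by rw [← sub_eq_iff_eq_add', ← hy]; rfl⟩
  by_contra hinf
  rw [not_finite_iff_infinite] at hinf
  set N := (Ideal.span {m}).toAddSubgroup.index with hN
  obtain ⟨q⟩ : Nonempty (Fin (N + 2) ↪ J ⧸ LinearMap.range (LinearMap.lsmul Z J m)) :=
    ⟨(Fin.valEmbedding).trans (Infinite.natEmbedding _)⟩
  choose x hx using fun i => Submodule.Quotient.mk_surjective _ (q i)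
  obtain ⟨b, hb⟩ := IsLocalization.exist_integer_multiples_of_finite (nonZeroDivisors Z)
    fun i => (x i : Q)
  choose z hz using hb
  have hb0 : algebraMap Z Q b ≠ 0 := by simp
  let I : Ideal Z := Ideal.span (Set.range z)
  have hzI : ∀ i, z i ∈ I := fun i => Ideal.subset_span ⟨i, rfl⟩
  have hIJ : ∀ w ∈ I, ∃ y : J, algebraMap Z Q w = (b : Z) • (y : Q) := by
    intro w hw
    induction hw using Submodule.span_induction with
    | mem w hw =>
      obtain ⟨i, rfl⟩ := hw
      exact ⟨x i, hz i⟩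
    | zero => exact ⟨0, by simp⟩
    | add u v _ _ hu hv =>
      obtain ⟨y, hy⟩ := hu
      obtain ⟨y', hy'⟩ := hv
      exact ⟨y + y', by rw [map_add, hy, hy', Submodule.coe_add, smul_add]⟩
    | smul c u _ hu =>
      obtain ⟨y, hy⟩ := hu
      refine ⟨c • y, ?_⟩
      rw [smul_eq_mul, map_mul, hy, Submodule.coe_smul, smul_comm, Algebra.smul_def c]
  have hinj : ∀ i j, ∀ w ∈ I, z i - z j = m * w → i = j := by
    intro i j w hw hij
    apply q.injective
    rw [← hx, ← hx, Submodule.Quotient.eq]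
    obtain ⟨y, hy⟩ := hIJ w hw
    refine ⟨y, Subtype.ext ?_⟩
    apply mul_left_cancel₀ hb0
    have h2 := congrArg (algebraMap Z Q) hij
    rw [map_sub, hz, hz, map_mul, hy] at h2
    simp only [Algebra.smul_def, Submodule.coe_sub, LinearMap.lsmul_apply,
      Submodule.coe_smul] at h2 ⊢
    rw [mul_sub, h2]
    ring
  have hI : I ≠ ⊥ := by
    intro h0
    have hz0 : ∀ i, z i = 0 := fun i => by simpa [h0] using hzI i
    have := hinj 0 1 0 I.zero_mem (by simp [hz0])
    simp at this
  have hcard := ideal_relIndex hZ hm I hI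
  rw [← hN, AddSubgroup.relIndex, AddSubgroup.index] at hcard
  have hN0 : N ≠ 0 := finite_quotient_ideal hZ _ (by simpa using hm)
  have := Nat.finite_of_card_ne_zero (hcard.trans_ne hN0)
  have hle := Nat.card_le_card_of_injective
    (fun i : Fin (N + 2) => (QuotientAddGroup.mk (⟨z i, hzI i⟩ : I.toAddSubgroup) :
      I.toAddSubgroup ⧸ (I.toAddSubgroup.map (AddMonoidHom.mulLeft m)).addSubgroupOf
        I.toAddSubgroup)) (by
    intro i j hij
    rw [QuotientAddGroup.eq] at hij
    obtain ⟨w, hw, hwe⟩ := AddSubgroup.mem_addSubgroupOf.mp hij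
    refine (hinj j i w hw ?_).symm
    have hwe' : m * w = -z i + z j := hwe
    rw [hwe']
    ring)
  rw [hcard] at hle
  simp at hle

theorem FiniteMod.of_linearMap_pi (hZ : ∀ m : Z, m ≠ 0 → Finite (Z ⧸ Ideal.span {m}))
    {m : Z} (hm : m ≠ 0) (n : ℕ) {X : Type*} [AddCommGroup X] [Module Z X]
    (φ : X →ₗ[Z] (Fin n → Q)) (h : FiniteMod m (LinearMap.ker φ)) : FiniteMod m X := by
  induction n generalizing X with
  | zero =>
    exact h.of_surjective (LinearMap.ker φ).subtype fun x =>
      ⟨⟨x, Subsingleton.elim _ _⟩, rfl⟩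
  | succ n ih =>
    let ψ : X →ₗ[Z] Q := LinearMap.proj 0 ∘ₗ φ
    refine FiniteMod.of_ker_of_range ψ ?_ (finiteMod_submodule_fractionRing hZ hm _)
    refine ih (LinearMap.funLeft Z Q Fin.succ ∘ₗ φ ∘ₗ (LinearMap.ker ψ).subtype) ?_
    have hk : ∀ x : LinearMap.ker φ, x.1 ∈ LinearMap.ker ψ := fun x => by
      simp [ψ, LinearMap.mem_ker.mp x.2]
    refine h.of_surjective (LinearMap.codRestrict _
      (LinearMap.codRestrict (LinearMap.ker ψ) (LinearMap.ker φ).subtype hk) fun x => ?_) ?_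
    · ext i
      exact congrFun (LinearMap.mem_ker.mp x.2) i.succ
    · rintro ⟨⟨x, hx⟩, hx'⟩
      refine ⟨⟨x, ?_⟩, rfl⟩
      ext i
      refine Fin.cases hx (fun j => congrFun (LinearMap.mem_ker.mp hx') j) i

end FiniteRank

section HasFiniteRank

variable {Z : Type*} [CommRing Z] {Q : Type*} [Field Q] [Algebra Z Q]

variable (Z Q) in
/-- A `Z`-module of finite rank with finite torsion: it has a homomorphism with finite kernel to a
finite dimensional vector space over the field of fractions `Q`. -/
def HasFiniteRank (X : Type*) [AddCommGroup X] [Module Z X] : Prop :=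
  ∃ (ι : Type) (_ : Finite ι) (φ : X →ₗ[Z] (ι → Q)), Finite (LinearMap.ker φ)

namespace HasFiniteRank

variable {X Y : Type*} [AddCommGroup X] [AddCommGroup Y] [Module Z Y]

section

variable [Module Z X]

theorem finiteMod [IsDomain Z] [IsFractionRing Z Q] (h : HasFiniteRank Z Q X)
    (hZ : ∀ m : Z, m ≠ 0 → Finite (Z ⧸ Ideal.span {m})) {m : Z} (hm : m ≠ 0) :
    FiniteMod m X := by
  obtain ⟨ι, hι, φ, hφ⟩ := h
  obtain ⟨n, ⟨e⟩⟩ := Finite.exists_equiv_fin ι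
  refine FiniteMod.of_linearMap_pi hZ hm n
    ((LinearEquiv.funCongrLeft Z Q e.symm).toLinearMap ∘ₗ φ) ?_
  rw [LinearEquiv.ker_comp]
  exact FiniteMod.of_finite m _

theorem finite_torsion [IsFractionRing Z Q] (h : HasFiniteRank Z Q X) :
    {x : X | ∃ m : Z, m ≠ 0 ∧ m • x = 0}.Finite := by
  obtain ⟨ι, hι, φ, hφ⟩ := h
  refine Set.Finite.subset (Set.toFinite (LinearMap.ker φ : Set X)) ?_
  rintro x ⟨m, hm, hx⟩
  have h1 : m • φ x = 0 := by rw [← map_smul, hx, map_zero]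
  ext i
  have h2 := congrFun h1 i
  rw [Pi.smul_apply, Algebra.smul_def] at h2
  exact (mul_eq_zero.mp h2).resolve_left (by simpa using hm)

theorem of_finite_ker (h : HasFiniteRank Z Q Y) (f : X →ₗ[Z] Y) (hf : Finite (LinearMap.ker f)) :
    HasFiniteRank Z Q X := by
  obtain ⟨ι, hι, φ, hφ⟩ := h
  refine ⟨ι, hι, φ ∘ₗ f, ?_⟩
  have h1 : (LinearMap.ker (φ ∘ₗ f) : Set X) ⊆ f ⁻¹' (LinearMap.ker φ : Set Y) := by
    intro x hx
    exact hx
  refine (Set.Finite.subset ?_ h1).to_subtype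
  refine Set.Finite.preimage' (Set.toFinite _) fun y _ => ?_
  by_cases hy : ∃ x, f x = y
  · obtain ⟨x, rfl⟩ := hy
    refine Set.Finite.subset ((Set.toFinite (LinearMap.ker f : Set X)).image (x + ·)) ?_
    intro x' hx'
    exact ⟨x' - x, by simpa [sub_eq_zero] using hx', by simp⟩
  · convert Set.finite_empty
    ext x
    simpa using fun hx => hy ⟨x, hx⟩

theorem pi (h : HasFiniteRank Z Q Y) (κ : Type) [Finite κ] : HasFiniteRank Z Q (κ → Y) := by
  obtain ⟨ι, hι, φ, hφ⟩ := h
  refine ⟨κ × ι, inferInstance,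
    LinearMap.pi fun p => LinearMap.proj p.2 ∘ₗ φ ∘ₗ LinearMap.proj p.1, ?_⟩
  refine Finite.of_injective (β := κ → LinearMap.ker φ)
    (fun x k => ⟨x.1 k, ?_⟩) fun x y hxy => ?_
  · ext i
    exact congrFun (LinearMap.mem_ker.mp x.2) (k, i)
  · ext k
    exact congrArg Subtype.val (congrFun hxy k)

end

/-- A homomorphism from a finitely generated module is determined by the images of generators. -/
theorem linearMap {R : Type*} [Ring R] [Algebra Z R] [Module R X] [Module R Y]
    [IsScalarTower Z R Y] [Module.Finite R X] (h : HasFiniteRank Z Q Y) :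
    HasFiniteRank Z Q (X →ₗ[R] Y) := by
  obtain ⟨k, s, hs⟩ := Module.Finite.exists_fin (R := R) (M := X)
  let f : (X →ₗ[R] Y) →ₗ[Z] (Fin k → Y) :=
    { toFun := fun g i => g (s i)
      map_add' := fun _ _ => rfl
      map_smul' := fun _ _ => rfl }
  refine (h.pi (Fin k)).of_finite_ker f ?_
  have : LinearMap.ker f = ⊥ := by
    rw [LinearMap.ker_eq_bot]
    intro g g' hg
    exact LinearMap.ext_on_range hs fun i => congrFun hg i
  rw [this]
  infer_instance

end HasFiniteRank

end HasFiniteRank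

/-! ### Clearing denominators and killing torsion -/

section Torsion

variable {Z : Type*} [CommRing Z] [IsDomain Z]

/-- A finite family of conditions, each preserved under multiplication and satisfied by some
non-zero element, is satisfied by a single non-zero element. -/
theorem exists_common_multiple {ι : Type*} [Finite ι] (P : ι → Z → Prop)
    (hP : ∀ i d e, P i d → P i (e * d)) (h : ∀ i, ∃ d, d ≠ 0 ∧ P i d) :
    ∃ d, d ≠ 0 ∧ ∀ i, P i d := by
  classical
  choose d hd hdP using h
  have := Fintype.ofFinite ι
  refine ⟨∏ i, d i, Finset.prod_ne_zero_iff.mpr fun i _ => hd i, fun i => ?_⟩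
  rw [← Finset.prod_erase_mul _ _ (Finset.mem_univ i)]
  exact hP i _ _ (hdP i)

/-- A finite set of torsion elements is killed by a single non-zero scalar. -/
theorem exists_smul_eq_zero_of_finite {X : Type*} [AddCommGroup X] [Module Z X] {S : Set X}
    (hS : S.Finite) (h : ∀ x ∈ S, ∃ m : Z, m ≠ 0 ∧ m • x = 0) :
    ∃ t : Z, t ≠ 0 ∧ ∀ x ∈ S, t • x = 0 := by
  have := hS.to_subtype
  obtain ⟨t, ht, h⟩ := exists_common_multiple (fun (x : S) (m : Z) => m • (x : X) = 0)
    (fun x d e hd => by rw [mul_smul, hd, smul_zero]) fun x => h x x.2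
  exact ⟨t, ht, fun x hx => h ⟨x, hx⟩⟩

theorem HasFiniteRank.exists_smul_eq_zero {Q : Type*} [Field Q] [Algebra Z Q] [IsFractionRing Z Q]
    {X : Type*} [AddCommGroup X] [Module Z X] (h : HasFiniteRank Z Q X) :
    ∃ t : Z, t ≠ 0 ∧ ∀ x : X, (∃ m : Z, m ≠ 0 ∧ m • x = 0) → t • x = 0 :=
  exists_smul_eq_zero_of_finite h.finite_torsion fun _ hx => hx

/-- As `Z` is infinite, every `Z`-stable subgroup of finite index contains `m X` for some
`m ≠ 0`. -/
theorem exists_smul_mem_of_finiteIndex {Z : Type*} [CommRing Z] [Infinite Z]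
    {X : Type*} [AddCommGroup X] [Module Z X]
    (K : AddSubgroup X) (hK : ∀ (z : Z), ∀ x ∈ K, z • x ∈ K) [K.FiniteIndex] :
    ∃ m : Z, m ≠ 0 ∧ ∀ x : X, m • x ∈ K := by
  have : Finite (X ⧸ K) := AddSubgroup.finite_quotient_of_finiteIndex
  obtain ⟨a, b, hab, h⟩ := Finite.exists_ne_map_eq_of_infinite
    fun (z : Z) (q : X ⧸ K) => (QuotientAddGroup.mk (z • q.out) : X ⧸ K)
  refine ⟨b - a, sub_ne_zero.mpr hab.symm, fun x => ?_⟩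
  have h1 := QuotientAddGroup.eq.mp (congrFun h (QuotientAddGroup.mk x))
  obtain ⟨k, hk⟩ := QuotientAddGroup.mk_out_eq_add K x
  rw [hk, neg_add_eq_sub, ← sub_smul, smul_add] at h1
  exact (K.add_mem_cancel_right (hK _ _ k.2)).mp h1

theorem exists_smul_eq_zero_of_finite_addSubgroup [Infinite Z] {X : Type*} [AddCommGroup X]
    [Module Z X] (K : AddSubgroup X) (hK : ∀ (z : Z), ∀ x ∈ K, z • x ∈ K) [Finite K] :
    ∃ m : Z, m ≠ 0 ∧ ∀ x ∈ K, m • x = 0 := by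
  refine exists_smul_eq_zero_of_finite (Set.toFinite (K : Set X)) fun x hx => ?_
  obtain ⟨a, b, hab, h⟩ := Finite.exists_ne_map_eq_of_infinite
    fun z : Z => (⟨z • x, hK z x hx⟩ : K)
  refine ⟨a - b, sub_ne_zero.mpr hab, ?_⟩
  rw [sub_smul, sub_eq_zero]
  exact congrArg Subtype.val h

/-- An isogeny of `R`-modules has an inverse up to multiplication by a non-zero `m ∈ Z`. -/
theorem IsAddIsogeny.exists_quasiInverse [Infinite Z] {R N L : Type*} [Ring R] [Algebra Z R]
    [AddCommGroup N] [Module R N] [Module Z N] [IsScalarTower Z R N]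
    [AddCommGroup L] [Module R L] [Module Z L] [IsScalarTower Z R L]
    (f : N →ₗ[R] L) (hf : IsAddIsogeny f.toAddMonoidHom) :
    ∃ m : Z, m ≠ 0 ∧ ∃ f' : L →ₗ[R] N, (∀ l, f (f' l) = m • l) ∧ ∀ n, f' (f n) = m • n := by
  have h1 := hf.1
  have h2 := hf.2
  obtain ⟨a, ha, hker⟩ := exists_smul_eq_zero_of_finite_addSubgroup (Z := Z)
    f.toAddMonoidHom.ker (fun z x hx => by
      change f (z • x) = 0
      rw [LinearMap.map_smul_of_tower, show f x = 0 from hx, smul_zero])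
  obtain ⟨b, hb, hrange⟩ := exists_smul_mem_of_finiteIndex (Z := Z)
    f.toAddMonoidHom.range (by
      rintro z _ ⟨x, rfl⟩
      exact ⟨z • x, LinearMap.map_smul_of_tower f z x⟩)
  have hrange : ∀ l, ∃ n, f n = b • l := hrange
  choose s hs using hrange
  have key : ∀ n l, f n = b • l → a • s l = a • n := by
    intro n l h
    rw [← sub_eq_zero, ← smul_sub]
    exact hker _ (show f (s l - n) = 0 by rw [map_sub, hs, h, sub_self])
  refine ⟨a * b, mul_ne_zero ha hb, ⟨⟨fun l => a • s l, fun l l' => ?_⟩, fun r l => ?_⟩,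
    fun l => ?_, fun n => ?_⟩
  · rw [key (s l + s l') (l + l') (by rw [map_add, hs, hs, smul_add]), smul_add]
  · change a • s (r • l) = r • a • s l
    rw [key (r • s l) (r • l) (by rw [map_smul, hs, smul_comm]), smul_comm]
  · change f (a • s l) = _
    rw [LinearMap.map_smul_of_tower, hs, mul_smul]
  · change a • s (f n) = _
    rw [key (b • n) (f n) (LinearMap.map_smul_of_tower f b n), mul_smul]

/-- Between modules of finite rank, a map with an inverse up to non-zero scalars is an isogeny. -/
theorem isAddIsogeny_of_quasiInverse {Q : Type*} [Field Q] [Algebra Z Q] [IsFractionRing Z Q]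
    (hZ : ∀ m : Z, m ≠ 0 → Finite (Z ⧸ Ideal.span {m}))
    {N L : Type*} [AddCommGroup N] [Module Z N] [AddCommGroup L] [Module Z L]
    (hN : HasFiniteRank Z Q N) (hL : HasFiniteRank Z Q L) (f : N →+ L) (a b : Z) (ha : a ≠ 0)
    (hb : b ≠ 0) (hker : ∀ n, f n = 0 → a • n = 0) (hrange : ∀ l, ∃ n, f n = b • l) :
    IsAddIsogeny f := by
  refine ⟨(hN.finite_torsion.subset fun n hn => ⟨a, ha, hker n hn⟩).to_subtype, ?_⟩
  exact (hL.finiteMod hZ hb).finiteIndex _ hrange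

end Torsion

/-! ### Finiteness of torsion in finitely generated modules -/

section FinitelyGenerated

variable {Z : Type*} [CommRing Z] [IsDomain Z] {Q : Type*} [Field Q] [Algebra Z Q]
  [IsFractionRing Z Q] {A : Type*} [Ring A] [Algebra Q A] [Algebra Z A] [IsScalarTower Z Q A]
  (R : Subalgebra Z A)

theorem HasFiniteRank.of_finiteDimensional (Z Q : Type*) [CommRing Z] [Field Q] [Algebra Z Q]
    (V : Type*) [AddCommGroup V] [Module Q V] [Module Z V] [IsScalarTower Z Q V]
    [FiniteDimensional Q V] : HasFiniteRank Z Q V := by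
  refine ⟨_, inferInstance, ((Module.finBasis Q V).equivFun.restrictScalars Z).toLinearMap, ?_⟩
  rw [LinearEquiv.ker]
  infer_instance

theorem exists_smul_mem_subalgebra (hR : Submodule.span Q (R : Set A) = ⊤) (a : A) :
    ∃ d : Z, d ≠ 0 ∧ d • a ∈ R := by
  have ha : a ∈ Submodule.span Q (R : Set A) := hR ▸ Submodule.mem_top
  induction ha using Submodule.span_induction with
  | mem x hx => exact ⟨1, one_ne_zero, by simpa using hx⟩
  | zero => exact ⟨1, one_ne_zero, by simp⟩
  | add x y _ _ hx hy =>
    obtain ⟨d, hd, hx⟩ := hx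
    obtain ⟨e, he, hy⟩ := hy
    refine ⟨d * e, mul_ne_zero hd he, ?_⟩
    rw [smul_add, mul_smul d e y, mul_comm d e, mul_smul]
    exact R.add_mem (R.smul_mem hx _) (R.smul_mem hy _)
  | smul q x _ hx =>
    obtain ⟨d, hd, hx⟩ := hx
    obtain ⟨n, e, he, rfl⟩ := IsFractionRing.div_surjective (A := Z) q
    have he0 : algebraMap Z Q e ≠ 0 := by simpa using nonZeroDivisors.ne_zero he
    refine ⟨d * e, mul_ne_zero hd (nonZeroDivisors.ne_zero he), ?_⟩
    have h1 : (d * e) • (algebraMap Z Q n / algebraMap Z Q e) • x = n • d • x := by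
      rw [← algebraMap_smul Q (d * e), ← algebraMap_smul Q n, ← algebraMap_smul Q d, smul_smul,
        smul_smul, map_mul]
      congr 1
      field_simp
    rw [h1]
    exact R.smul_mem hx _

/-- The torsion of a finitely generated `R`-module `L = Rᵏ / P` is finite: a projection of `Aᵏ`
onto the span of `P` provides a denominator `d` with `d P' ⊆ P`, where `P'` is the saturation
of `P`, so that the torsion `P' / P` is a quotient of the finite group `P' / d P'`. -/
theorem finite_torsion_of_finite [FiniteDimensional Q A] [IsSemisimpleRing A]
    (hZ : ∀ m : Z, m ≠ 0 → Finite (Z ⧸ Ideal.span {m}))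
    (hR : Submodule.span Q (R : Set A) = ⊤)
    (L : Type*) [AddCommGroup L] [Module R L] [Module Z L] [IsScalarTower Z R L]
    [Module.Finite R L] : {l : L | ∃ m : Z, m ≠ 0 ∧ m • l = 0}.Finite := by
  obtain ⟨k, π, hπ⟩ := Module.Finite.exists_fin' R L
  let j : (Fin k → R) → (Fin k → A) := fun x i => x i
  have hj : ∀ x y, j x = j y → x = y := fun x y h => funext fun i => Subtype.ext (congrFun h i)
  have hjsmul : ∀ (r : R) (x : Fin k → R), j (r • x) = (r : A) • j x := fun r x => rfl
  have hjZ : ∀ (z : Z) (x : Fin k → R), j (z • x) = z • j x := fun z x => rfl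
  let P : Submodule A (Fin k → A) := Submodule.span A (j '' {x | π x = 0})
  have hP : ∀ y ∈ P, ∃ d : Z, d ≠ 0 ∧ ∃ x, π x = 0 ∧ j x = d • y := by
    intro y hy
    induction hy using Submodule.span_induction with
    | mem y hy =>
      obtain ⟨x, hx, rfl⟩ := hy
      exact ⟨1, one_ne_zero, x, hx, by simp⟩
    | zero => exact ⟨1, one_ne_zero, 0, by simp, by ext; simp [j]⟩
    | add y z _ _ hy hz =>
      obtain ⟨d, hd, x, hx, hxy⟩ := hy
      obtain ⟨e, he, w, hw, hwz⟩ := hz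
      refine ⟨e * d, mul_ne_zero he hd, e • x + d • w, ?_, ?_⟩
      · rw [map_add, LinearMap.map_smul_of_tower, LinearMap.map_smul_of_tower, hx, hw]
        simp
      · have h1 : j (e • x + d • w) = e • j x + d • j w := rfl
        rw [h1, hxy, hwz, smul_add, smul_smul, smul_smul, mul_comm d e]
    | smul a y _ hy =>
      obtain ⟨d, hd, x, hx, hxy⟩ := hy
      obtain ⟨e, he, hr⟩ := exists_smul_mem_subalgebra R hR a
      refine ⟨e * d, mul_ne_zero he hd, (⟨e • a, hr⟩ : R) • x, by rw [map_smul, hx, smul_zero], ?_⟩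
      rw [hjsmul, hxy]
      ext i
      simp [mul_smul, smul_comm d e]
  obtain ⟨h, hh⟩ := IsSemisimpleModule.extension_property P.subtype P.subtype_injective
    LinearMap.id
  obtain ⟨d, hd, hdx⟩ := exists_common_multiple
    (fun (i : Fin k) (d : Z) => ∃ x, π x = 0 ∧ j x = d • (h (Pi.single i 1) : Fin k → A))
    (fun i d e ⟨x, hx, hxy⟩ => ⟨e • x, by rw [LinearMap.map_smul_of_tower, hx, smul_zero],
      by rw [hjZ, hxy, mul_smul]⟩) fun i => hP _ (h (Pi.single i 1)).2
  choose p hp hpj using hdx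
  have hkill : ∀ x, (∃ m : Z, m ≠ 0 ∧ m • π x = 0) → d • π x = 0 := by
    rintro x ⟨m, hm, hmx⟩
    have h1 : j x ∈ P := by
      have h2 : m • j x ∈ P := by
        rw [← hjZ]
        refine Submodule.subset_span ⟨m • x, ?_, rfl⟩
        change π (m • x) = 0
        rw [LinearMap.map_smul_of_tower, hmx]
      have h3 : j x = (algebraMap Q A (algebraMap Z Q m)⁻¹) • (m • j x) := by
        have hmQ : algebraMap Z Q m ≠ 0 := by simpa using hm
        ext i
        rw [Pi.smul_apply, Pi.smul_apply, smul_eq_mul, ← Algebra.smul_def,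
          ← algebraMap_smul Q m, smul_smul, inv_mul_cancel₀ hmQ, one_smul]
      rw [h3]
      exact P.smul_mem _ h2
    have h4 : j x = ∑ i, (x i : A) • (h (Pi.single i 1) : Fin k → A) := by
      have h5 : (h (j x) : Fin k → A) = j x := congrArg Subtype.val (LinearMap.congr_fun hh ⟨_, h1⟩)
      have h6 : j x = ∑ i, (x i : A) • (Pi.single i 1 : Fin k → A) := by
        ext i
        simp [j, Finset.sum_apply, Pi.single_apply]
      rw [← h5]
      conv_lhs => rw [h6, map_sum]
      simp [map_smul]
    have h7 : d • x = ∑ i, x i • p i := by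
      apply hj
      have h8 : j (∑ i, x i • p i) = ∑ i, (x i : A) • j (p i) := by
        ext a
        simp [j, Finset.sum_apply]
      rw [h8, hjZ, h4, Finset.smul_sum]
      refine Finset.sum_congr rfl fun i _ => ?_
      rw [hpj, smul_comm]
    rw [← LinearMap.map_smul_of_tower, h7, map_sum]
    exact Finset.sum_eq_zero fun i _ => by rw [map_smul, hp, smul_zero]
  let P' : Submodule Z (Fin k → R) := LinearMap.ker (LinearMap.lsmul Z L d ∘ₗ π.restrictScalars Z)
  let jP : P' →ₗ[Z] (Fin k → A) :=
    { toFun := fun x => j x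
      map_add' := fun _ _ => rfl
      map_smul' := fun _ _ => rfl }
  have hfin : HasFiniteRank Z Q P' := by
    refine ((HasFiniteRank.of_finiteDimensional Z Q A).pi (Fin k)).of_finite_ker jP ?_
    have : LinearMap.ker jP = ⊥ :=
      LinearMap.ker_eq_bot.mpr fun x y hxy => Subtype.ext (hj _ _ hxy)
    rw [this]
    infer_instance
  obtain ⟨S, hS, hrep⟩ := hfin.finiteMod hZ hd
  refine (hS.image fun x : P' => π (x : Fin k → R)).subset fun l hl => ?_
  obtain ⟨x, rfl⟩ := hπ l
  obtain ⟨s, hs, y, hy⟩ := hrep ⟨x, hkill x hl⟩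
  refine ⟨s, hs, ?_⟩
  have hy' : x = s + d • (y : Fin k → R) := congrArg Subtype.val hy
  have hy0 : d • π (y : Fin k → R) = 0 := y.2
  rw [hy', map_add, LinearMap.map_smul_of_tower, hy0, add_zero]

end FinitelyGenerated

/-! ### Isogenies of rings and of their unit groups -/

section RingIsogeny

theorem finite_ker_unitsMap {W E : Type*} [Ring W] [Ring E] (π : W →+* E)
    [Finite π.toAddMonoidHom.ker] : Finite (Units.map (π : W →* E)).ker := by
  refine Finite.of_injective (β := π.toAddMonoidHom.ker)
    (fun u => ⟨(u.1 : W) - 1, ?_⟩) fun u v huv => ?_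
  · have h : π (u.1 : W) = 1 := congrArg Units.val (MonoidHom.mem_ker.mp u.2)
    change π ((u.1 : W) - 1) = 0
    rw [map_sub, h, map_one, sub_self]
  · have h : (u.1 : W) - 1 = (v.1 : W) - 1 := congrArg Subtype.val huv
    exact Subtype.ext (Units.ext (sub_left_injective h))

theorem one_add_mul_one_add {E : Type*} [Ring E] (a b : E) :
    (1 + a) * (1 + b) = 1 + (a + b + a * b) := by
  noncomm_ring

/-- A ring homomorphism `π : W → E` with finite kernel is an isogeny, and so is the map that it
induces on units, if it has an additive section `s` up to a non-zero scalar `k` which is compatible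
with products. Namely, let `t` kill the torsion of `E`. If `1 + k t α` is a unit with inverse
`1 + k t β`, then `1 + s (t α)` and `1 + s (t β)` are inverse to each other, so that the image of `Wˣ`
contains every unit which, with its inverse, is congruent to `1` modulo `k t`. -/
theorem isIsogeny_of_section {Z : Type*} [CommRing Z] [IsDomain Z] {Q : Type*} [Field Q]
    [Algebra Z Q] [IsFractionRing Z Q] (hZ : ∀ m : Z, m ≠ 0 → Finite (Z ⧸ Ideal.span {m}))
    {W E : Type*} [Ring W] [Ring E] [Algebra Z E] (hE : HasFiniteRank Z Q E) (π : W →+* E)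
    (hπ : Finite π.toAddMonoidHom.ker) (s : E →+ W) (k : Z) (hk : k ≠ 0)
    (hs : ∀ x, π (s x) = k • x) (hmul : ∀ x y, s x * s y = s (k • (x * y))) :
    IsAddIsogeny π.toAddMonoidHom ∧ IsGroupIsogeny (Units.map (π : W →* E)) := by
  refine ⟨⟨hπ, (hE.finiteMod hZ hk).finiteIndex _ fun x => ⟨s x, hs x⟩⟩,
    finite_ker_unitsMap π, ?_⟩
  obtain ⟨t, ht, htor⟩ := hE.exists_smul_eq_zero
  have hkt : k * t ≠ 0 := mul_ne_zero hk ht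
  have hinv : ∀ α β : E, (1 + (k * t) • α) * (1 + (k * t) • β) = 1 →
      (1 + s (t • α)) * (1 + s (t • β)) = 1 := by
    intro α β h
    have h1 : (k * t) • (α + β + (k * t) • (α * β)) = 0 := by
      rw [one_add_mul_one_add, add_eq_left, smul_mul_smul_comm] at h
      rw [smul_add, smul_add, smul_smul, h]
    have h2 := htor _ ⟨_, hkt, h1⟩
    have h3 : t • α + t • β + k • ((t • α) * (t • β)) = t • (α + β + (k * t) • (α * β)) := by
      simp only [smul_add, smul_mul_smul_comm, smul_smul]
      congr 2
      ring
    rw [one_add_mul_one_add, hmul, ← map_add, ← map_add, h3, h2, map_zero, add_zero]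
  have hlift : ∀ (u : Eˣ) (α β : E), (u : E) = 1 + (k * t) • α →
      ((u⁻¹ : Eˣ) : E) = 1 + (k * t) • β →
      u ∈ (Units.map (π : W →* E)).range := by
    intro u α β hα hβ
    refine ⟨⟨1 + s (t • α), 1 + s (t • β), hinv α β ?_, hinv β α ?_⟩, ?_⟩
    · rw [← hα, ← hβ, Units.mul_inv]
    · rw [← hα, ← hβ, Units.inv_mul]
    · ext
      change π (1 + s (t • α)) = u
      rw [map_add, map_one, hs, smul_smul, hα]
  obtain ⟨S, hS, hrep⟩ := hE.finiteMod hZ hkt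
  have := hS.to_subtype
  choose r hr y hy using hrep
  have : Finite (Eˣ ⧸ (Units.map (π : W →* E)).range) := by
    refine Finite.of_injective (β := S) (fun q => ⟨r (q.out : Eˣ), hr _⟩) fun q q' hqq => ?_
    have h1 : r (q.out : Eˣ) = r (q'.out : Eˣ) := congrArg Subtype.val hqq
    rw [← q.out_eq', ← q'.out_eq']
    refine QuotientGroup.eq.mpr (hlift _ (↑q.out⁻¹ * (y (q'.out : Eˣ) - y (q.out : Eˣ)))
      (↑q'.out⁻¹ * (y (q.out : Eˣ) - y (q'.out : Eˣ))) ?_ ?_)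
    · rw [← mul_smul_comm, smul_sub, Units.val_mul, ← sub_eq_iff_eq_add', ← Units.inv_mul q.out,
        ← mul_sub]
      congr 1
      nth_rw 1 [hy (q.out : Eˣ), hy (q'.out : Eˣ), h1]
      abel
    · rw [← mul_smul_comm, smul_sub, mul_inv_rev, inv_inv, Units.val_mul, ← sub_eq_iff_eq_add',
        ← Units.inv_mul q'.out, ← mul_sub]
      congr 1
      nth_rw 1 [hy (q.out : Eˣ), hy (q'.out : Eˣ), h1]
      abel
  exact Subgroup.finiteIndex_of_finite_quotient

end RingIsogeny

/-! ### The ring and group commensurabilities attached to a module commensurability -/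

namespace ModuleCorrespondence

variable {R : Type u} [Ring R] {L M : Type v} [AddCommGroup L] [Module R L]
  [AddCommGroup M] [Module R M]

/-- The action of `Z` on the middle term of a correspondence of modules over a `Z`-algebra. -/
@[reducible] def moduleMiddle (Z : Type*) [CommRing Z] [Algebra Z R]
    (c : ModuleCorrespondence R L M) : Module Z c.N :=
  Module.compHom c.N (algebraMap Z R)

theorem isScalarTower_middle (Z : Type*) [CommRing Z] [Algebra Z R]
    (c : ModuleCorrespondence R L M) :
    let := c.moduleMiddle Z
    IsScalarTower Z R c.N := by
  let := c.moduleMiddle Z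
  refine ⟨fun z r x => ?_⟩
  change (z • r) • x = algebraMap Z R z • r • x
  rw [Algebra.smul_def, mul_smul]

variable {Z : Type*} [CommRing Z] [Algebra Z R] [Module Z L] [Module Z M]

/-- Inverses up to scalars of the two legs of a correspondence. -/
structure QuasiInverse (Z : Type*) [CommRing Z] [Algebra Z R] [Module Z L] [Module Z M]
    (c : ModuleCorrespondence R L M) [Module Z c.N] where
  m : Z
  n : Z
  m_ne : m ≠ 0
  n_ne : n ≠ 0
  f' : L →ₗ[R] c.N
  g' : M →ₗ[R] c.N
  f_f' : ∀ l, c.f (f' l) = m • l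
  f'_f : ∀ x, f' (c.f x) = m • x
  g_g' : ∀ l, c.g (g' l) = n • l
  g'_g : ∀ x, g' (c.g x) = n • x

theorem IsCommensurability.nonempty_quasiInverse [IsDomain Z] [Infinite Z]
    [IsScalarTower Z R L] [IsScalarTower Z R M] {c : ModuleCorrespondence R L M}
    [Module Z c.N] [IsScalarTower Z R c.N] (hc : c.IsCommensurability) :
    Nonempty (QuasiInverse Z c) := by
  obtain ⟨m, hm, f', h1, h2⟩ := hc.1.exists_quasiInverse (Z := Z) c.f
  obtain ⟨n, hn, g', h3, h4⟩ := hc.2.exists_quasiInverse (Z := Z) c.g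
  exact ⟨⟨m, n, hm, hn, f', g', h1, h2, h3, h4⟩⟩

section Sections

variable {c : ModuleCorrespondence R L M} [Module Z c.N] [IsScalarTower Z R c.N]
  (q : QuasiInverse Z c)

/-- The section `End L → End c` of `End c → End L` up to the scalar `m n`. -/
def QuasiInverse.sectionFst [IsScalarTower Z R L] [IsScalarTower Z R M] :
    Module.End R L →+ c.endRing where
  toFun x := ⟨((q.m * q.n) • x, q.n • (q.f' ∘ₗ x ∘ₗ c.f), c.g ∘ₗ q.f' ∘ₗ x ∘ₗ c.f ∘ₗ q.g'), by
    constructor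
    · ext y
      simp [q.f_f', LinearMap.map_smul_of_tower, smul_smul, mul_comm]
    · ext y
      simp [q.g'_g, LinearMap.map_smul_of_tower]⟩
  map_zero' := by
    ext <;> simp
  map_add' x y := by
    ext <;> simp

/-- The section `End M → End c` of `End c → End M` up to the scalar `m n`. -/
def QuasiInverse.sectionSnd [IsScalarTower Z R L] [IsScalarTower Z R M] :
    Module.End R M →+ c.endRing where
  toFun x := ⟨(c.f ∘ₗ q.g' ∘ₗ x ∘ₗ c.g ∘ₗ q.f', q.m • (q.g' ∘ₗ x ∘ₗ c.g), (q.m * q.n) • x), by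
    constructor
    · ext y
      simp [q.f'_f, LinearMap.map_smul_of_tower]
    · ext y
      simp [q.g_g', LinearMap.map_smul_of_tower, smul_smul]⟩
  map_zero' := by
    ext <;> simp
  map_add' x y := by
    ext <;> simp

theorem QuasiInverse.sectionFst_mul [IsScalarTower Z R L] [IsScalarTower Z R M]
    (x y : Module.End R L) :
    q.sectionFst x * q.sectionFst y = q.sectionFst ((q.m * q.n) • (x * y)) := by
  ext z
  · simp [sectionFst]
  · simp only [sectionFst, AddMonoidHom.coe_mk, ZeroHom.coe_mk, Subring.coe_mul, Prod.mk_mul_mk,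
      Module.End.mul_apply, LinearMap.smul_apply, LinearMap.comp_apply, q.f_f',
      LinearMap.map_smul_of_tower, smul_smul]
    congr 1
    ring
  · simp only [sectionFst, AddMonoidHom.coe_mk, ZeroHom.coe_mk, Subring.coe_mul, Prod.mk_mul_mk,
      Module.End.mul_apply, LinearMap.smul_apply, LinearMap.comp_apply, q.f_f', q.g'_g,
      LinearMap.map_smul_of_tower, smul_smul]
    congr 1
    ring

theorem QuasiInverse.sectionSnd_mul [IsScalarTower Z R L] [IsScalarTower Z R M]
    (x y : Module.End R M) :
    q.sectionSnd x * q.sectionSnd y = q.sectionSnd ((q.m * q.n) • (x * y)) := by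
  ext z
  · simp only [sectionSnd, AddMonoidHom.coe_mk, ZeroHom.coe_mk, Subring.coe_mul, Prod.mk_mul_mk,
      Module.End.mul_apply, LinearMap.smul_apply, LinearMap.comp_apply, q.f'_f, q.g_g',
      LinearMap.map_smul_of_tower, smul_smul]
  · simp only [sectionSnd, AddMonoidHom.coe_mk, ZeroHom.coe_mk, Subring.coe_mul, Prod.mk_mul_mk,
      Module.End.mul_apply, LinearMap.smul_apply, LinearMap.comp_apply, q.g_g',
      LinearMap.map_smul_of_tower, smul_smul]
  · simp [sectionSnd]

theorem QuasiInverse.g_f'_fst [IsScalarTower Z R L] [IsScalarTower Z R M]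
    (t : c.endRing) (l : L) :
    q.m • c.g (q.f' (t.1.1 l)) = q.m • t.1.2.2 (c.g (q.f' l)) := by
  have h1 := LinearMap.congr_fun t.2.1
  have h2 := LinearMap.congr_fun t.2.2
  simp only [LinearMap.comp_apply] at h1 h2
  have h3 : q.m • t.1.2.1 (q.f' l) = q.m • q.f' (t.1.1 l) := by
    rw [← q.f'_f, ← h1, q.f_f', LinearMap.map_smul_of_tower, LinearMap.map_smul_of_tower]
  rw [h2, ← LinearMap.map_smul_of_tower c.g, ← LinearMap.map_smul_of_tower c.g, h3]

/-- If `(0, ν, μ)` belongs to `End c` then `m ν = f' f ν = 0` and `m n μ = m μ g g' = m g ν g' = 0`,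
so that `ν` and `μ` are torsion. -/
theorem QuasiInverse.finite_ker_endFst [IsDomain Z] [IsScalarTower Z R M]
    {Q : Type*} [Field Q] [Algebra Z Q] [IsFractionRing Z Q] (q : QuasiInverse Z c)
    (hZ : ∀ m : Z, m ≠ 0 → Finite (Z ⧸ Ideal.span {m}))
    (hN : HasFiniteRank Z Q c.N) (hM : HasFiniteRank Z Q M) :
    Finite c.endFst.toAddMonoidHom.ker := by
  have hNf := (hN.finiteMod hZ q.m_ne).finite_linearMap (R := R)
    (hN.finite_torsion.subset fun y hy => ⟨q.m, q.m_ne, hy⟩)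
  have hmn := mul_ne_zero q.m_ne q.n_ne
  have hMf := (hM.finiteMod hZ hmn).finite_linearMap (R := R)
    (hM.finite_torsion.subset fun y hy => ⟨_, hmn, hy⟩)
  have := hNf.to_subtype
  have := hMf.to_subtype
  have key : ∀ t : c.endFst.toAddMonoidHom.ker,
      t.1.1.1 = 0 ∧ q.m • t.1.1.2.1 = 0 ∧ (q.m * q.n) • t.1.1.2.2 = 0 := by
    rintro ⟨⟨⟨x, ν, μ⟩, h⟩, hx⟩
    have hx : x = 0 := hx
    have h1 := LinearMap.congr_fun h.1
    have h2 := LinearMap.congr_fun h.2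
    simp only [LinearMap.comp_apply, hx, LinearMap.zero_apply] at h1 h2
    have h3 : ∀ y, q.m • ν y = 0 := fun y => by rw [← q.f'_f, ← h1, map_zero]
    refine ⟨hx, LinearMap.ext h3, LinearMap.ext fun y => ?_⟩
    change (q.m * q.n) • μ y = 0
    rw [mul_smul, ← LinearMap.map_smul_of_tower μ, ← q.g_g', h2,
      ← LinearMap.map_smul_of_tower c.g, h3, map_zero]
  refine Finite.of_injective
    (β := {ν : c.N →ₗ[R] c.N | q.m • ν = 0} × {μ : M →ₗ[R] M | (q.m * q.n) • μ = 0})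
    (fun t => (⟨t.1.1.2.1, (key t).2.1⟩, ⟨t.1.1.2.2, (key t).2.2⟩)) fun t t' htt => ?_
  refine Subtype.ext (Subtype.ext (Prod.ext ((key t).1.trans (key t').1.symm) (Prod.ext ?_ ?_)))
  · exact congrArg (fun p => p.1.1) htt
  · exact congrArg (fun p => p.2.1) htt

theorem QuasiInverse.finite_ker_endSnd [IsDomain Z] [IsScalarTower Z R L]
    {Q : Type*} [Field Q] [Algebra Z Q] [IsFractionRing Z Q] (q : QuasiInverse Z c)
    (hZ : ∀ m : Z, m ≠ 0 → Finite (Z ⧸ Ideal.span {m}))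
    (hN : HasFiniteRank Z Q c.N) (hL : HasFiniteRank Z Q L) :
    Finite c.endSnd.toAddMonoidHom.ker := by
  have hNf := (hN.finiteMod hZ q.n_ne).finite_linearMap (R := R)
    (hN.finite_torsion.subset fun y hy => ⟨q.n, q.n_ne, hy⟩)
  have hmn := mul_ne_zero q.n_ne q.m_ne
  have hLf := (hL.finiteMod hZ hmn).finite_linearMap (R := R)
    (hL.finite_torsion.subset fun y hy => ⟨_, hmn, hy⟩)
  have := hNf.to_subtype
  have := hLf.to_subtype
  have key : ∀ t : c.endSnd.toAddMonoidHom.ker,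
      t.1.1.2.2 = 0 ∧ q.n • t.1.1.2.1 = 0 ∧ (q.n * q.m) • t.1.1.1 = 0 := by
    rintro ⟨⟨⟨x, ν, μ⟩, h⟩, hx⟩
    have hx : μ = 0 := hx
    have h1 := LinearMap.congr_fun h.1
    have h2 := LinearMap.congr_fun h.2
    simp only [LinearMap.comp_apply, hx, LinearMap.zero_apply] at h1 h2
    have h3 : ∀ y, q.n • ν y = 0 := fun y => by rw [← q.g'_g, ← h2, map_zero]
    refine ⟨hx, LinearMap.ext h3, LinearMap.ext fun y => ?_⟩
    change (q.n * q.m) • x y = 0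
    rw [mul_smul, ← LinearMap.map_smul_of_tower x, ← q.f_f', h1,
      ← LinearMap.map_smul_of_tower c.f, h3, map_zero]
  refine Finite.of_injective
    (β := {ν : c.N →ₗ[R] c.N | q.n • ν = 0} × {x : L →ₗ[R] L | (q.n * q.m) • x = 0})
    (fun t => (⟨t.1.1.2.1, (key t).2.1⟩, ⟨t.1.1.1, (key t).2.2⟩)) fun t t' htt => ?_
  refine Subtype.ext (Subtype.ext (Prod.ext ?_ (Prod.ext ?_ ((key t).1.trans (key t').1.symm))))
  · exact congrArg (fun p => p.2.1) htt
  · exact congrArg (fun p => p.1.1) htt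

end Sections

theorem IsCommensurability.e_and_a [IsDomain Z] [Infinite Z]
    [IsScalarTower Z R L] [IsScalarTower Z R M]
    {Q : Type*} [Field Q] [Algebra Z Q] [IsFractionRing Z Q]
    (hZ : ∀ m : Z, m ≠ 0 → Finite (Z ⧸ Ideal.span {m})) [Module.Finite R L] [Module.Finite R M]
    (hL : HasFiniteRank Z Q L) (hM : HasFiniteRank Z Q M) {c : ModuleCorrespondence R L M}
    (hc : c.IsCommensurability) : c.e.IsCommensurability ∧ c.a.IsCommensurability := by
  let := c.moduleMiddle Z
  have := c.isScalarTower_middle Z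
  obtain ⟨q⟩ := hc.nonempty_quasiInverse (Z := Z)
  have hN : HasFiniteRank Z Q c.N := hL.of_finite_ker (c.f.restrictScalars Z) hc.1.1
  have hmn := mul_ne_zero q.m_ne q.n_ne
  have h1 := isIsogeny_of_section hZ (hL.linearMap (R := R) (X := L)) c.endFst
    (q.finite_ker_endFst hZ hN hM) q.sectionFst (q.m * q.n) hmn (fun _ => rfl) q.sectionFst_mul
  have h2 := isIsogeny_of_section hZ (hM.linearMap (R := R) (X := M)) c.endSnd
    (q.finite_ker_endSnd hZ hN hL) q.sectionSnd (q.m * q.n) hmn (fun _ => rfl) q.sectionSnd_mul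
  exact ⟨⟨h1.1, h2.1⟩, ⟨h1.2, h2.2⟩⟩

end ModuleCorrespondence

/-! ### Rational hulls -/

section RationalHull

variable {Z : Type*} [CommRing Z] {A : Type*} [Ring A] [Algebra Z A]

/-- An additive map `ι` from an `R`-module `L` to an `A`-module `V` that has the properties of
`L → Q ⊗ L`, where `A` is an algebra over the field of fractions `Q` of `Z`: it is compatible with
the actions of `R ⊆ A`, its kernel consists of torsion elements, and every element of `V` has a
non-zero multiple in the image. Scalars of `Z` act on `V` through their images in `A`, which are
invertible, so that `V` carries no other module structure. -/
structure IsRationalHull (R : Subalgebra Z A) {L V : Type*} [AddCommGroup L] [Module R L]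
    [Module Z L] [AddCommGroup V] [Module A V] (ι : L →+ V) : Prop where
  isUnit : ∀ d : Z, d ≠ 0 → IsUnit (algebraMap Z A d)
  map_smul : ∀ (r : R) (l : L), ι (r • l) = (r : A) • ι l
  torsion_of_eq_zero : ∀ l, ι l = 0 → ∃ m : Z, m ≠ 0 ∧ m • l = 0
  exists_smul_eq : ∀ v, ∃ d : Z, d ≠ 0 ∧ ∃ l, algebraMap Z A d • v = ι l

variable {R : Subalgebra Z A} {L M V V' : Type*} [AddCommGroup L] [Module R L]
  [Module Z L] [AddCommGroup M] [Module R M] [Module Z M] [IsScalarTower Z R M]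
  [AddCommGroup V] [Module A V] [AddCommGroup V'] [Module A V'] {ι : L →+ V} {ι' : M →+ V'}

namespace IsRationalHull

theorem map_base_smul [IsScalarTower Z R L] (h : IsRationalHull R ι) (z : Z) (l : L) :
    ι (z • l) = algebraMap Z A z • ι l := by
  rw [← algebraMap_smul R z l, h.map_smul]
  rfl

theorem hom_ext (h : IsRationalHull R ι) {φ ψ : V →ₗ[A] V'} (hφ : ∀ l, φ (ι l) = ψ (ι l)) :
    φ = ψ := by
  ext v
  obtain ⟨d, hd, l, hl⟩ := h.exists_smul_eq v
  rw [← (h.isUnit d hd).smul_left_cancel, ← LinearMap.map_smul,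
    ← LinearMap.map_smul, hl, hφ]

theorem finite_hull [Module.Finite R L] (h : IsRationalHull R ι) : Module.Finite A V := by
  obtain ⟨k, s, hs⟩ := Module.Finite.exists_fin (R := R) (M := L)
  refine ⟨Submodule.fg_def.mpr ⟨Set.range fun i => ι (s i), Set.finite_range _, ?_⟩⟩
  rw [eq_top_iff]
  have hι : ∀ l, ι l ∈ Submodule.span A (Set.range fun i => ι (s i)) := by
    intro l
    have hl : l ∈ Submodule.span R (Set.range s) := hs ▸ Submodule.mem_top
    induction hl using Submodule.span_induction with
    | mem l hl =>
      obtain ⟨i, rfl⟩ := hl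
      exact Submodule.subset_span ⟨i, rfl⟩
    | zero => simp
    | add l l' _ _ hl hl' => rw [map_add]; exact Submodule.add_mem _ hl hl'
    | smul r l _ hl => rw [h.map_smul]; exact Submodule.smul_mem _ _ hl
  intro v _
  obtain ⟨d, hd, l, hl⟩ := h.exists_smul_eq v
  obtain ⟨u, hu⟩ := h.isUnit d hd
  have hv : v = (↑u⁻¹ : A) • ι l := by rw [← hl, ← hu, smul_smul, Units.inv_mul, one_smul]
  rw [hv]
  exact Submodule.smul_mem _ _ (hι l)

/-- Every `A`-linear map between rational hulls comes from an `R`-linear map up to a non-zero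
scalar. The denominators of the images of generators of `L` lead to a map from `L` to the image
of `M`; multiplication by a scalar that kills the torsion of `M` lifts it to `M`. -/
theorem exists_lift [IsDomain Z] {Q : Type*} [Field Q] [Algebra Z Q] [IsFractionRing Z Q]
    [Module.Finite R L] (h : IsRationalHull R ι) (h' : IsRationalHull R ι')
    (hM : HasFiniteRank Z Q M) (φ : V →ₗ[A] V') :
    ∃ d : Z, d ≠ 0 ∧ ∃ p : L →ₗ[R] M, ∀ l, ι' (p l) = algebraMap Z A d • φ (ι l) := by
  obtain ⟨k, s, hs⟩ := Module.Finite.exists_fin (R := R) (M := L)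
  obtain ⟨t, ht, htor⟩ := hM.exists_smul_eq_zero
  obtain ⟨d, hd, hds⟩ := exists_common_multiple
    (fun (i : Fin k) (d : Z) => ∃ m, algebraMap Z A d • φ (ι (s i)) = ι' m)
    (fun i d e ⟨m, hm⟩ => ⟨e • m, by rw [h'.map_base_smul, ← hm, map_mul, mul_smul]⟩)
    fun i => h'.exists_smul_eq _
  have hall : ∀ l, ∃ m, ι' m = algebraMap Z A d • φ (ι l) := by
    intro l
    have hl : l ∈ Submodule.span R (Set.range s) := hs ▸ Submodule.mem_top
    induction hl using Submodule.span_induction with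
    | mem l hl =>
      obtain ⟨i, rfl⟩ := hl
      obtain ⟨m, hm⟩ := hds i
      exact ⟨m, hm.symm⟩
    | zero => exact ⟨0, by simp⟩
    | add l l' _ _ hl hl' =>
      obtain ⟨m, hm⟩ := hl
      obtain ⟨m', hm'⟩ := hl'
      exact ⟨m + m', by rw [map_add, hm, hm', map_add, map_add, smul_add]⟩
    | smul r l _ hl =>
      obtain ⟨m, hm⟩ := hl
      refine ⟨r • m, ?_⟩
      rw [h'.map_smul, hm, h.map_smul, LinearMap.map_smul, smul_smul, smul_smul, Algebra.commutes]
  choose g hg using hall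
  have key : ∀ m l, ι' m = algebraMap Z A d • φ (ι l) → t • g l = t • m := by
    intro m l hm
    rw [← sub_eq_zero, ← smul_sub]
    exact htor _ (h'.torsion_of_eq_zero _ (by rw [map_sub, hg, hm, sub_self]))
  refine ⟨t * d, mul_ne_zero ht hd, ⟨⟨fun l => t • g l, fun l l' => ?_⟩, fun r l => ?_⟩,
    fun l => ?_⟩
  · rw [key (g l + g l') (l + l') (by rw [map_add, hg, hg, map_add, map_add, smul_add]), smul_add]
  · change t • g (r • l) = r • t • g l
    rw [key (r • g l) (r • l), smul_comm]
    rw [h'.map_smul, hg, h.map_smul, LinearMap.map_smul, smul_smul, smul_smul, Algebra.commutes]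
  · change ι' (t • g l) = _
    rw [h'.map_base_smul, hg, map_mul, mul_smul]

variable [IsScalarTower Z R L]

theorem eq_zero_of_smul_eq_zero (h : IsRationalHull R ι) {m : Z} (hm : m ≠ 0) {l : L}
    (hl : m • l = 0) : ι l = 0 := by
  rw [← (h.isUnit m hm).smul_left_cancel, ← h.map_base_smul, hl, map_zero,
    smul_zero]

theorem apply_eq_smul (h : IsRationalHull R ι) (σ : V →ₗ[A] V) (k : Z)
    (hσ : ∀ l, σ (ι l) = ι (k • l)) (v : V) : σ v = algebraMap Z A k • v := by
  obtain ⟨d, hd, l, hl⟩ := h.exists_smul_eq v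
  rw [← (h.isUnit d hd).smul_left_cancel, ← LinearMap.map_smul, hl, hσ, h.map_base_smul, ← hl,
    smul_smul, smul_smul, Algebra.commutes]

variable [IsDomain Z] {Q : Type*} [Field Q] [Algebra Z Q] [IsFractionRing Z Q]
  [Algebra Q A] [IsScalarTower Z Q A]

/-- Every `R`-linear map extends to the rational hulls. -/
theorem exists_extension (h : IsRationalHull R ι) (h' : IsRationalHull R ι')
    (hR : Submodule.span Q (R : Set A) = ⊤) (p : L →ₗ[R] M) :
    ∃ φ : V →ₗ[A] V', ∀ l, φ (ι l) = ι' (p l) := by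
  have hex : ∀ v, ∃ w, ∀ (d : Z) (l : L), algebraMap Z A d • v = ι l →
      algebraMap Z A d • w = ι' (p l) := by
    intro v
    obtain ⟨e, he, k, hk⟩ := h.exists_smul_eq v
    obtain ⟨u, hu⟩ := h.isUnit e he
    have hw : algebraMap Z A e • (↑u⁻¹ : A) • ι' (p k) = ι' (p k) := by
      rw [← hu, smul_smul, Units.mul_inv, one_smul]
    refine ⟨(↑u⁻¹ : A) • ι' (p k), fun d l hl => ?_⟩
    rw [← (h.isUnit e he).smul_left_cancel, smul_smul, Algebra.commutes e, mul_smul, hw,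
      ← h'.map_base_smul, ← h'.map_base_smul, ← LinearMap.map_smul_of_tower,
      ← LinearMap.map_smul_of_tower, ← sub_eq_zero, ← map_sub, ← map_sub]
    obtain ⟨m, hm, hml⟩ := h.torsion_of_eq_zero (d • k - e • l) (by
      rw [map_sub, h.map_base_smul, h.map_base_smul, ← hk, ← hl, smul_smul, smul_smul,
        Algebra.commutes, sub_self])
    refine h'.eq_zero_of_smul_eq_zero hm ?_
    rw [← LinearMap.map_smul_of_tower, hml, map_zero]
  choose φ hφ using hex
  have huniq : ∀ v w (d : Z) (l : L), d ≠ 0 → algebraMap Z A d • v = ι l →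
      algebraMap Z A d • w = ι' (p l) → φ v = w := by
    intro v w d l hd hv hw
    rw [← (h.isUnit d hd).smul_left_cancel, hφ v d l hv, hw]
  refine ⟨⟨⟨φ, fun v w => ?_⟩, fun a v => ?_⟩, fun l => ?_⟩
  · obtain ⟨d, hd, l, hl⟩ := h.exists_smul_eq v
    obtain ⟨e, he, k, hk⟩ := h.exists_smul_eq w
    refine huniq _ _ (d * e) (e • l + d • k) (mul_ne_zero hd he) ?_ ?_
    · rw [map_add, h.map_base_smul, h.map_base_smul, ← hl, ← hk, smul_smul, smul_smul, ← map_mul,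
        ← map_mul, smul_add, mul_comm e d]
    · rw [map_add, LinearMap.map_smul_of_tower, LinearMap.map_smul_of_tower, map_add,
        h'.map_base_smul, h'.map_base_smul, ← hφ v d l hl, ← hφ w e k hk, smul_smul, smul_smul,
        ← map_mul, ← map_mul, smul_add, mul_comm e d]
  · change φ (a • v) = a • φ v
    obtain ⟨d, hd, l, hl⟩ := h.exists_smul_eq v
    obtain ⟨e, he, hr⟩ := exists_smul_mem_subalgebra R hR a
    have hcomm : ∀ x : A, algebraMap Z A (e * d) * x = (e • x) * algebraMap Z A d := by
      intro x
      rw [map_mul, Algebra.smul_def, mul_assoc, mul_assoc, Algebra.commutes d]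
    refine huniq _ _ (e * d) ((⟨e • a, hr⟩ : R) • l) (mul_ne_zero he hd) ?_ ?_
    · rw [smul_smul, hcomm, mul_smul, hl, h.map_smul]
    · rw [smul_smul, hcomm, mul_smul, hφ v d l hl, LinearMap.map_smul, h'.map_smul]
  · exact huniq _ _ 1 l one_ne_zero (by simp) (by simp)

/-- The ring homomorphism `End L → End V` given by extension of endomorphisms. -/
noncomputable def mapEnd (h : IsRationalHull R ι) (hR : Submodule.span Q (R : Set A) = ⊤) :
    Module.End R L →+* Module.End A V where
  toFun p := (h.exists_extension h hR p).choose
  map_one' := h.hom_ext fun l => (h.exists_extension h hR 1).choose_spec l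
  map_mul' p q := h.hom_ext fun l => by
    rw [(h.exists_extension h hR _).choose_spec, Module.End.mul_apply, Module.End.mul_apply,
      (h.exists_extension h hR _).choose_spec, (h.exists_extension h hR _).choose_spec]
  map_zero' := h.hom_ext fun l => by
    rw [(h.exists_extension h hR _).choose_spec]
    simp
  map_add' p q := h.hom_ext fun l => by
    rw [(h.exists_extension h hR _).choose_spec, LinearMap.add_apply, LinearMap.add_apply,
      (h.exists_extension h hR _).choose_spec, (h.exists_extension h hR _).choose_spec, map_add]

theorem mapEnd_apply (h : IsRationalHull R ι) (hR : Submodule.span Q (R : Set A) = ⊤)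
    (p : Module.End R L) (l : L) : h.mapEnd hR p (ι l) = ι (p l) :=
  (h.exists_extension h hR p).choose_spec l

theorem hasFiniteRank [Module.Finite R L] [FiniteDimensional Q A] [IsSemisimpleRing A]
    (h : IsRationalHull R ι) (hZ : ∀ m : Z, m ≠ 0 → Finite (Z ⧸ Ideal.span {m}))
    (hR : Submodule.span Q (R : Set A) = ⊤) : HasFiniteRank Z Q L := by
  let : Module Q V := Module.compHom V (algebraMap Q A)
  let : Module Z V := Module.compHom V (algebraMap Z A)
  have : IsScalarTower Q A V := ⟨fun q a v => by
    change (q • a) • v = algebraMap Q A q • a • v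
    rw [Algebra.smul_def, mul_smul]⟩
  have : IsScalarTower Z Q V := ⟨fun z q v => by
    change algebraMap Q A (z • q) • v = algebraMap Z A z • algebraMap Q A q • v
    rw [Algebra.smul_def, map_mul, mul_smul, IsScalarTower.algebraMap_apply Z Q A]⟩
  have := h.finite_hull
  have : Module.Finite Q V := Module.Finite.trans A V
  let f : L →ₗ[Z] V :=
    { toFun := ι
      map_add' := map_add ι
      map_smul' := h.map_base_smul }
  exact (HasFiniteRank.of_finiteDimensional Z Q V).of_finite_ker f
    ((finite_torsion_of_finite R hZ hR L).subset h.torsion_of_eq_zero).to_subtype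

end IsRationalHull

end RationalHull

/-! ### Commensurabilities and isomorphisms of rational hulls -/

namespace ModuleCorrespondence

variable {Z : Type*} [CommRing Z] [IsDomain Z] {A : Type*} [Ring A] [Algebra Z A]
  {Q : Type*} [Field Q] [Algebra Z Q] [IsFractionRing Z Q] [Algebra Q A] [IsScalarTower Z Q A]
  {R : Subalgebra Z A} {L M : Type v} {V V' : Type*} [AddCommGroup L] [Module R L]
  [Module Z L] [IsScalarTower Z R L] [AddCommGroup M] [Module R M] [Module Z M]
  [IsScalarTower Z R M] [AddCommGroup V] [Module A V] [AddCommGroup V'] [Module A V']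
  {ι : L →+ V} {ι' : M →+ V'}

/-- An isomorphism of rational hulls is induced by a correspondence `c` if it intertwines the
actions of `End c`. -/
def Induces (c : ModuleCorrespondence R L M) (h : IsRationalHull R ι) (h' : IsRationalHull R ι')
    (hR : Submodule.span Q (R : Set A) = ⊤) (φ : V ≃ₗ[A] V') : Prop :=
  ∀ (t : c.endRing) (v : V), φ (h.mapEnd hR t.1.1 v) = h'.mapEnd hR t.1.2.2 (φ v)

theorem IsCommensurability.exists_induces [Infinite Z] {c : ModuleCorrespondence R L M}
    (hc : c.IsCommensurability) (h : IsRationalHull R ι) (h' : IsRationalHull R ι')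
    (hR : Submodule.span Q (R : Set A) = ⊤) : ∃ φ : V ≃ₗ[A] V', c.Induces h h' hR φ := by
  let := c.moduleMiddle Z
  have := c.isScalarTower_middle Z
  obtain ⟨q⟩ := hc.nonempty_quasiInverse (Z := Z)
  obtain ⟨φ, hφ⟩ := h.exists_extension h' hR (c.g ∘ₗ q.f')
  obtain ⟨ψ, hψ⟩ := h'.exists_extension h hR (c.f ∘ₗ q.g')
  have hmn := mul_ne_zero q.m_ne q.n_ne
  obtain ⟨u, hu⟩ := h.isUnit _ hmn
  have h1 : ∀ v, ψ (φ v) = (u : A) • v := by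
    rw [hu]
    refine h.apply_eq_smul (ψ ∘ₗ φ) _ fun l => ?_
    rw [LinearMap.comp_apply, hφ, hψ, LinearMap.comp_apply, LinearMap.comp_apply, q.g'_g,
      LinearMap.map_smul_of_tower, q.f_f', smul_smul, mul_comm]
  have h2 : ∀ w, φ (ψ w) = (u : A) • w := by
    rw [hu]
    refine h'.apply_eq_smul (φ ∘ₗ ψ) _ fun l => ?_
    rw [LinearMap.comp_apply, hψ, hφ, LinearMap.comp_apply, LinearMap.comp_apply, q.f'_f,
      LinearMap.map_smul_of_tower, q.g_g', smul_smul]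
  have hbij : Function.Bijective φ := by
    refine ⟨fun v w hvw => ?_, fun w => ⟨(↑u⁻¹ : A) • ψ w, ?_⟩⟩
    · rw [← u.isUnit.smul_left_cancel, ← h1, ← h1, hvw]
    · rw [map_smul, h2, smul_smul, Units.inv_mul, one_smul]
  refine ⟨LinearEquiv.ofBijective φ hbij, fun t v => ?_⟩
  have key : φ ∘ₗ h.mapEnd hR t.1.1 = h'.mapEnd hR t.1.2.2 ∘ₗ φ := by
    refine h.hom_ext fun l => ?_
    rw [LinearMap.comp_apply, LinearMap.comp_apply, h.mapEnd_apply, hφ, hφ, h'.mapEnd_apply,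
      ← (h.isUnit _ q.m_ne).smul_left_cancel, ← h'.map_base_smul, ← h'.map_base_smul]
    exact congrArg ι' (q.g_f'_fst t l)
  exact LinearMap.congr_fun key v

/-- Every isomorphism of rational hulls is induced by a commensurability, namely by one of the form
`L ← L → M` in which the first map is multiplication by an element of `Z`. -/
theorem exists_isCommensurability_induces [Module.Finite R L] [Module.Finite R M]
    (hZ : ∀ m : Z, m ≠ 0 → Finite (Z ⧸ Ideal.span {m})) (h : IsRationalHull R ι)
    (h' : IsRationalHull R ι') (hR : Submodule.span Q (R : Set A) = ⊤) (hL : HasFiniteRank Z Q L)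
    (hM : HasFiniteRank Z Q M) (φ : V ≃ₗ[A] V') :
    ∃ c : ModuleCorrespondence R L M, c.IsCommensurability ∧ c.Induces h h' hR φ := by
  obtain ⟨d, hd, p, hp⟩ := h.exists_lift h' hM φ.toLinearMap
  obtain ⟨e, he, q, hq⟩ := h'.exists_lift h hL φ.symm.toLinearMap
  obtain ⟨s, hs, hsL⟩ := hL.exists_smul_eq_zero
  obtain ⟨t, ht, htM⟩ := hM.exists_smul_eq_zero
  simp only [LinearEquiv.coe_coe] at hp hq
  have hqp : ∀ l, s • q (p l) = s • (e * d) • l := by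
    intro l
    rw [← sub_eq_zero, ← smul_sub]
    refine hsL _ (h.torsion_of_eq_zero _ ?_)
    rw [map_sub, hq, hp, map_smul, φ.symm_apply_apply, h.map_base_smul, map_mul, mul_smul, sub_self]
  have hpq : ∀ m, t • p (q m) = t • (d * e) • m := by
    intro m
    rw [← sub_eq_zero, ← smul_sub]
    refine htM _ (h'.torsion_of_eq_zero _ ?_)
    rw [map_sub, hp, hq, map_smul, φ.apply_symm_apply, h'.map_base_smul, map_mul, mul_smul,
      sub_self]
  refine ⟨⟨L, d • LinearMap.id, p⟩, ⟨?_, ?_⟩, ?_⟩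
  · exact isAddIsogeny_of_quasiInverse hZ hL hL _ d d hd hd (fun l hl => hl) fun l => ⟨l, rfl⟩
  · refine isAddIsogeny_of_quasiInverse hZ hL hM _ (s * (e * d)) (t * (d * e))
      (mul_ne_zero hs (mul_ne_zero he hd)) (mul_ne_zero ht (mul_ne_zero hd he)) (fun l hl => ?_)
      fun m => ⟨t • q m, ?_⟩
    · have hl : p l = 0 := hl
      rw [mul_smul, ← hqp, hl, map_zero, smul_zero]
    · change p (t • q m) = _
      rw [LinearMap.map_smul_of_tower, hpq, smul_smul]
  · rintro ⟨⟨x, ν, μ⟩, h1, h2⟩ v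
    have h1 : ∀ l, x (d • l) = d • ν l := LinearMap.congr_fun h1
    have h2 : ∀ l, μ (p l) = p (ν l) := LinearMap.congr_fun h2
    have key : φ.toLinearMap ∘ₗ h.mapEnd hR x = h'.mapEnd hR μ ∘ₗ φ.toLinearMap := by
      refine h.hom_ext fun l => ?_
      change φ (h.mapEnd hR x (ι l)) = h'.mapEnd hR μ (φ (ι l))
      rw [← (h.isUnit d hd).smul_left_cancel, ← map_smul, ← map_smul, ← h.map_base_smul,
        h.mapEnd_apply, h1, h.map_base_smul, map_smul, ← hp, ← h2, ← h'.mapEnd_apply hR, hp,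
        LinearMap.map_smul]
    exact LinearMap.congr_fun key v

end ModuleCorrespondence

/-! ### Independence of the indices -/

section EndConj

variable {A V V' : Type*} [Ring A] [AddCommGroup V] [Module A V] [AddCommGroup V'] [Module A V']

/-- Conjugation by automorphisms of a module, acting on its endomorphism ring. -/
def endConj (A V : Type*) [Ring A] [AddCommGroup V] [Module A V] :
    (Module.End A V)ˣ →* RingAut (Module.End A V) where
  toFun b := (LinearMap.GeneralLinearGroup.generalLinearEquiv A V b).conjRingEquiv
  map_one' := by ext; rfl
  map_mul' _ _ := by ext; rfl

/-- The automorphism that a ring automorphism induces on the additive group, written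
multiplicatively. -/
def RingAut.toMulAutMultiplicative (B : Type*) [Ring B] :
    RingAut B →* MulAut (Multiplicative B) where
  toFun σ := AddEquiv.toMultiplicative σ.toAddEquiv
  map_one' := rfl
  map_mul' _ _ := rfl

/-- The automorphism that a ring automorphism induces on the group of units. -/
def RingAut.toMulAutUnits (B : Type*) [Ring B] : RingAut B →* MulAut Bˣ where
  toFun σ := Units.mapEquiv σ.toMulEquiv
  map_one' := rfl
  map_mul' _ _ := rfl

theorem endConj_eq_one_of_central (z : (Module.End A V)ˣ)
    (hz : ∀ x, z.val * x = x * z.val) : endConj A V z = 1 := by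
  ext x v
  change z.val (x ((z⁻¹).val v)) = x v
  have h1 := LinearMap.congr_fun (hz x) ((z⁻¹).val v)
  have h2 : z.val ((z⁻¹).val v) = v := LinearMap.congr_fun z.mul_inv v
  rw [Module.End.mul_apply, Module.End.mul_apply, h2] at h1
  exact h1

theorem IsAddIsogeny.toMultiplicative {H G : Type*} [AddGroup H] [AddGroup G] {f : H →+ G}
    (hf : IsAddIsogeny f) : IsGroupIsogeny (AddMonoidHom.toMultiplicative f) :=
  ⟨hf.1, ⟨hf.2.index_ne_zero⟩⟩

/-- Two isomorphisms of modules differ by an automorphism, and the conjugations of endomorphism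
rings differ accordingly. -/
theorem conjRingEquiv_trans_symm (φ φ' : V ≃ₗ[A] V') :
    φ.conjRingEquiv.trans φ'.conjRingEquiv.symm = endConj A V
      ((LinearMap.GeneralLinearGroup.generalLinearEquiv A V).symm (φ.trans φ'.symm)) :=
  rfl

end EndConj

namespace IsRationalHull

variable {Z : Type*} [CommRing Z] [IsDomain Z] {A : Type*} [Ring A] [Algebra Z A]
  {Q : Type*} [Field Q] [Algebra Z Q] [IsFractionRing Z Q] [Algebra Q A] [IsScalarTower Z Q A]
  {R : Subalgebra Z A} {L V : Type*} [AddCommGroup L] [Module R L]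
  [Module Z L] [IsScalarTower Z R L] [AddCommGroup V] [Module A V] {ι : L →+ V}

theorem finite_ker_mapEnd [Module.Finite R L] (h : IsRationalHull R ι)
    (hR : Submodule.span Q (R : Set A) = ⊤) (hL : HasFiniteRank Z Q L) :
    Finite (h.mapEnd hR).toAddMonoidHom.ker := by
  obtain ⟨t, ht, htor⟩ := hL.exists_smul_eq_zero
  refine ((hL.linearMap (R := R) (X := L)).finite_torsion.subset fun x hx => ⟨t, ht, ?_⟩).to_subtype
  ext l
  refine htor _ (h.torsion_of_eq_zero _ ?_)
  rw [← h.mapEnd_apply hR, show h.mapEnd hR x = 0 from hx, LinearMap.zero_apply]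

end IsRationalHull

namespace ModuleCorrespondence

variable {Z : Type*} [CommRing Z] [IsDomain Z] {A : Type*} [Ring A] [Algebra Z A]
  {Q : Type*} [Field Q] [Algebra Z Q] [IsFractionRing Z Q] [Algebra Q A] [IsScalarTower Z Q A]
  {R : Subalgebra Z A} {L M : Type v} {V V' : Type*} [AddCommGroup L] [Module R L]
  [Module Z L] [IsScalarTower Z R L] [AddCommGroup M] [Module R M] [Module Z M]
  [IsScalarTower Z R M] [AddCommGroup V] [Module A V] [AddCommGroup V'] [Module A V']
  {ι : L →+ V} {ι' : M →+ V'}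

theorem Induces.mapEnd_endSnd {c : ModuleCorrespondence R L M} {h : IsRationalHull R ι}
    {h' : IsRationalHull R ι'} {hR : Submodule.span Q (R : Set A) = ⊤} {φ : V ≃ₗ[A] V'}
    (hφ : c.Induces h h' hR φ) (t : c.endRing) :
    h'.mapEnd hR (c.endSnd t) = φ.conjRingEquiv (h.mapEnd hR (c.endFst t)) := by
  ext v
  change h'.mapEnd hR t.1.2.2 v = φ (h.mapEnd hR t.1.1 (φ.symm v))
  rw [hφ, φ.apply_symm_apply]

theorem Induces.comp_add {c : ModuleCorrespondence R L M} {h : IsRationalHull R ι}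
    {h' : IsRationalHull R ι'} {hR : Submodule.span Q (R : Set A) = ⊤} {φ : V ≃ₗ[A] V'}
    (hφ : c.Induces h h' hR φ) :
    (AddMonoidHom.toMultiplicative (h'.mapEnd hR).toAddMonoidHom).comp
        (AddMonoidHom.toMultiplicative c.endSnd.toAddMonoidHom) =
      (AddEquiv.toMultiplicative φ.conjRingEquiv.toAddEquiv).toMonoidHom.comp
        ((AddMonoidHom.toMultiplicative (h.mapEnd hR).toAddMonoidHom).comp
          (AddMonoidHom.toMultiplicative c.endFst.toAddMonoidHom)) :=
  MonoidHom.ext fun t => hφ.mapEnd_endSnd t.toAdd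

theorem Induces.comp_units {c : ModuleCorrespondence R L M} {h : IsRationalHull R ι}
    {h' : IsRationalHull R ι'} {hR : Submodule.span Q (R : Set A) = ⊤} {φ : V ≃ₗ[A] V'}
    (hφ : c.Induces h h' hR φ) :
    (Units.map (h'.mapEnd hR : Module.End R M →* Module.End A V')).comp
        (Units.map (c.endSnd : c.endRing →* Module.End R M)) =
      (Units.mapEquiv φ.conjRingEquiv.toMulEquiv).toMonoidHom.comp
        ((Units.map (h.mapEnd hR : Module.End R L →* Module.End A V)).comp
          (Units.map (c.endFst : c.endRing →* Module.End R L))) :=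
  MonoidHom.ext fun t => Units.ext (hφ.mapEnd_endSnd t.val)

section

variable [Infinite Z] [Module.Finite R L] [FiniteDimensional Q A] [IsSemisimpleRing A]

/-- Automorphisms of the rational hull preserve the sizes of the images of `End L` and `Aut L`. -/
theorem relIndexRatio_range_eq_one (hZ : ∀ m : Z, m ≠ 0 → Finite (Z ⧸ Ideal.span {m}))
    (h : IsRationalHull R ι) (hR : Submodule.span Q (R : Set A) = ⊤) (b : (Module.End A V)ˣ) :
    relIndexRatio ((AddMonoidHom.toMultiplicative (h.mapEnd hR).toAddMonoidHom).range.map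
        (RingAut.toMulAutMultiplicative _ (endConj A V b)).toMonoidHom)
        (AddMonoidHom.toMultiplicative (h.mapEnd hR).toAddMonoidHom).range = 1 ∧
      relIndexRatio ((Units.map (h.mapEnd hR : Module.End R L →* Module.End A V)).range.map
        (RingAut.toMulAutUnits _ (endConj A V b)).toMonoidHom)
        (Units.map (h.mapEnd hR : Module.End R L →* Module.End A V)).range = 1 := by
  let : Module Q V := Module.compHom V (algebraMap Q A)
  have : IsScalarTower Q A V := ⟨fun q a v => by
    change (q • a) • v = algebraMap Q A q • a • v
    rw [Algebra.smul_def, mul_smul]⟩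
  have := h.finite_hull
  have : Module.Finite Q V := Module.Finite.trans A V
  have : IsSemisimpleRing (Module.End A V) := IsSemisimpleRing.moduleEnd A V
  have : FiniteDimensional Q (Module.End A V) := by
    let f : Module.End A V →ₗ[Q] (V →ₗ[Q] V) :=
      { toFun := fun x => x.restrictScalars Q
        map_add' := fun _ _ => rfl
        map_smul' := fun _ _ => rfl }
    exact FiniteDimensional.of_injective f (LinearMap.restrictScalars_injective Q)
  have : Infinite Q := Infinite.of_injective _ (IsFractionRing.injective Z Q)
  have hL : HasFiniteRank Z Q L := h.hasFiniteRank hZ hR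
  have hc : ∀ b : (Module.End A V)ˣ, ∃ c : ModuleCorrespondence R L L,
      c.e.IsCommensurability ∧ c.a.IsCommensurability ∧
      c.Induces h h hR (LinearMap.GeneralLinearGroup.generalLinearEquiv A V b) := by
    intro b
    obtain ⟨c, hc, hcb⟩ := exists_isCommensurability_induces hZ h h hR hL hL
      (LinearMap.GeneralLinearGroup.generalLinearEquiv A V b)
    obtain ⟨he, ha⟩ := hc.e_and_a hZ hL hL
    exact ⟨c, he, ha, hcb⟩
  constructor
  · refine relIndexRatio_map_semisimple (Q := Q)
      ((RingAut.toMulAutMultiplicative _).comp (endConj A V)) _ (fun b => ?_) (fun z hz => ?_) b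
    · obtain ⟨c, he, -, hcb⟩ := hc b
      exact (commensurable_of_isGroupIsogeny _ _ he.1.toMultiplicative he.2.toMultiplicative _ _ _
        hcb.comp_add).symm
    · rw [MonoidHom.comp_apply, endConj_eq_one_of_central z hz, map_one]
  · refine relIndexRatio_map_semisimple (Q := Q)
      ((RingAut.toMulAutUnits _).comp (endConj A V)) _ (fun b => ?_) (fun z hz => ?_) b
    · obtain ⟨c, -, ha, hcb⟩ := hc b
      exact (commensurable_of_isGroupIsogeny _ _ ha.1 ha.2 _ _ _ hcb.comp_units).symm
    · rw [MonoidHom.comp_apply, endConj_eq_one_of_central z hz, map_one]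

/-- The indices of `e(c)` and `a(c)` are the same for all commensurabilities `c`, since the
isomorphisms of rational hulls that two commensurabilities induce differ by an automorphism. -/
theorem index_eq_of_isCommensurability [Module.Finite R M]
    (hZ : ∀ m : Z, m ≠ 0 → Finite (Z ⧸ Ideal.span {m})) (h : IsRationalHull R ι)
    (h' : IsRationalHull R ι') (hR : Submodule.span Q (R : Set A) = ⊤)
    {c c' : ModuleCorrespondence R L M} (hc : c.IsCommensurability)
    (hc' : c'.IsCommensurability) : c.e.index = c'.e.index ∧ c.a.index = c'.a.index := by
  have hL : HasFiniteRank Z Q L := h.hasFiniteRank hZ hR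
  have hM : HasFiniteRank Z Q M := h'.hasFiniteRank hZ hR
  obtain ⟨φ, hφ⟩ := hc.exists_induces h h' hR
  obtain ⟨φ', hφ'⟩ := hc'.exists_induces h h' hR
  obtain ⟨he, ha⟩ := hc.e_and_a hZ hL hM
  obtain ⟨he', ha'⟩ := hc'.e_and_a hZ hL hM
  obtain ⟨hadd, hunits⟩ := relIndexRatio_range_eq_one hZ h hR
    ((LinearMap.GeneralLinearGroup.generalLinearEquiv A V).symm (φ.trans φ'.symm))
  have h1 := h.finite_ker_mapEnd hR hL
  have h2 := h'.finite_ker_mapEnd hR hM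
  rw [← conjRingEquiv_trans_symm] at hadd hunits
  constructor
  · have h3 : Finite (AddMonoidHom.toMultiplicative (h.mapEnd hR).toAddMonoidHom).ker := h1
    have h4 : Finite (AddMonoidHom.toMultiplicative (h'.mapEnd hR).toAddMonoidHom).ker := h2
    exact groupIsogenyIndex_div_eq (AddMonoidHom.toMultiplicative c.endFst.toAddMonoidHom)
      (AddMonoidHom.toMultiplicative c.endSnd.toAddMonoidHom)
      he.1.toMultiplicative he.2.toMultiplicative
      (AddMonoidHom.toMultiplicative c'.endFst.toAddMonoidHom)
      (AddMonoidHom.toMultiplicative c'.endSnd.toAddMonoidHom)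
      he'.1.toMultiplicative he'.2.toMultiplicative
      (AddMonoidHom.toMultiplicative (h.mapEnd hR).toAddMonoidHom)
      (AddMonoidHom.toMultiplicative (h'.mapEnd hR).toAddMonoidHom)
      (AddEquiv.toMultiplicative φ.conjRingEquiv.toAddEquiv)
      (AddEquiv.toMultiplicative φ'.conjRingEquiv.toAddEquiv) hφ.comp_add hφ'.comp_add hadd
  · have := finite_ker_unitsMap (h.mapEnd hR)
    have := finite_ker_unitsMap (h'.mapEnd hR)
    exact groupIsogenyIndex_div_eq (Units.map (c.endFst : c.endRing →* Module.End R L))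
      (Units.map (c.endSnd : c.endRing →* Module.End R M)) ha.1 ha.2
      (Units.map (c'.endFst : c'.endRing →* Module.End R L))
      (Units.map (c'.endSnd : c'.endRing →* Module.End R M)) ha'.1 ha'.2
      (Units.map (h.mapEnd hR : Module.End R L →* Module.End A V))
      (Units.map (h'.mapEnd hR : Module.End R M →* Module.End A V'))
      (Units.mapEquiv φ.conjRingEquiv.toMulEquiv) (Units.mapEquiv φ'.conjRingEquiv.toMulEquiv)
      hφ.comp_units hφ'.comp_units hunits

end

end ModuleCorrespondence

/-! ### The module `Q ⊗ L` as a rational hull -/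

theorem isRationalHull_tensorProduct {Z : Type*} [CommRing Z] [IsDomain Z]
    (Q : Type*) [Field Q] [Algebra Z Q] [IsFractionRing Z Q]
    {A : Type*} [Ring A] [Algebra Q A] [Algebra Z A] [IsScalarTower Z Q A]
    (R : Subalgebra Z A) (hR : Submodule.span Q (R : Set A) = ⊤)
    (L : Type*) [AddCommGroup L] [Module R L] [Module Z L] [IsScalarTower Z R L] :
    let := scalarExtensionModule Q R hR L
    IsRationalHull R (TensorProduct.mk Z Q L 1).toAddMonoidHom := by
  let := scalarExtensionModule Q R hR L
  have hsmul : ∀ (d : Z) (v : Q ⊗[Z] L), algebraMap Z A d • v = d • v := by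
    intro d v
    change scalarExtensionAction Q R hR L (algebraMap Z A d) v = d • v
    rw [IsScalarTower.algebraMap_apply Z Q A, AlgHom.commutes]
    exact algebraMap_smul Q d v
  constructor
  · intro d hd
    rw [IsScalarTower.algebraMap_apply Z Q A]
    exact (IsUnit.mk0 (algebraMap Z Q d) (by simpa using hd)).map (algebraMap Q A)
  · intro r l
    have := scalarExtensionModule_smul_tmul Q R hR L 1 1 r l
    rw [one_smul, one_mul] at this
    exact this.symm
  · intro l hl
    have hloc : IsLocalizedModule (nonZeroDivisors Z) (TensorProduct.mk Z Q L 1) :=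
      (isLocalizedModule_iff_isBaseChange (nonZeroDivisors Z) Q _).mpr
        (TensorProduct.isBaseChange Z L Q)
    obtain ⟨m, hm⟩ := (IsLocalizedModule.eq_zero_iff (nonZeroDivisors Z)
      (TensorProduct.mk Z Q L 1)).mp hl
    exact ⟨m, nonZeroDivisors.coe_ne_zero m, hm⟩
  · intro v
    have hloc : IsLocalizedModule (nonZeroDivisors Z) (TensorProduct.mk Z Q L 1) :=
      (isLocalizedModule_iff_isBaseChange (nonZeroDivisors Z) Q _).mpr
        (TensorProduct.isBaseChange Z L Q)
    obtain ⟨⟨l, d⟩, hld⟩ := IsLocalizedModule.surj (nonZeroDivisors Z)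
      (TensorProduct.mk Z Q L 1) v
    exact ⟨d, nonZeroDivisors.coe_ne_zero d, l, (hsmul _ _).trans hld⟩

theorem theorem1p2
    {Z : Type*} [CommRing Z] [IsDomain Z] [Infinite Z]
    (hZ : ∀ m : Z, m ≠ 0 → Finite (Z ⧸ Ideal.span {m}))
    (Q : Type*) [Field Q] [Algebra Z Q] [IsFractionRing Z Q]
    {A : Type*} [Ring A] [Algebra Q A] [Algebra Z A] [IsScalarTower Z Q A]
    [IsSemisimpleRing A] [FiniteDimensional Q A]
    (R : Subalgebra Z A) (hR : Submodule.span Q (R : Set A) = ⊤)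
    (L M : Type v)
    [AddCommGroup L] [Module R L] [Module Z L] [IsScalarTower Z R L] [Module.Finite R L]
    [AddCommGroup M] [Module R M] [Module Z M] [IsScalarTower Z R M] [Module.Finite R M] :
    ((∃ c : ModuleCorrespondence R L M, c.IsCommensurability) ↔
      (letI := scalarExtensionModule Q R hR L
       letI := scalarExtensionModule Q R hR M
       Nonempty ((Q ⊗[Z] L) ≃ₗ[A] (Q ⊗[Z] M)))) ∧
    (∀ c : ModuleCorrespondence R L M, c.IsCommensurability →
      c.e.IsCommensurability ∧ c.a.IsCommensurability) ∧
    (∀ c c' : ModuleCorrespondence R L M, c.IsCommensurability → c'.IsCommensurability →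
      c.e.index = c'.e.index ∧ c.a.index = c'.a.index) := by
  let := scalarExtensionModule Q R hR L
  let := scalarExtensionModule Q R hR M
  have h := isRationalHull_tensorProduct Q R hR L
  have h' := isRationalHull_tensorProduct Q R hR M
  have hL : HasFiniteRank Z Q L := h.hasFiniteRank hZ hR
  have hM : HasFiniteRank Z Q M := h'.hasFiniteRank hZ hR
  refine ⟨⟨fun ⟨c, hc⟩ => ?_, fun ⟨φ⟩ => ?_⟩, fun c hc => hc.e_and_a hZ hL hM,
    fun c c' hc hc' => ModuleCorrespondence.index_eq_of_isCommensurability hZ h h' hR hc hc'⟩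
  · obtain ⟨φ, -⟩ := hc.exists_induces h h' hR
    exact ⟨φ⟩
  · obtain ⟨c, hc, -⟩ :=
      ModuleCorrespondence.exists_isCommensurability_induces hZ h h' hR hL hM φ
    exact ⟨c, hc⟩
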